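/- Let $P,Q\in\mathbb C[z_1,\dots,z_n]$ be $\mathbb D$-stable polynomials (neither has a zero in $\{|z_j|<1,\ j=1,\dots,n\}$) satisfying, for some $\ell=(\ell_1,\dots,\ell_n)$ with non-negative integer entries and some constant $\eta$, the functional equation $$Q(z_1,\dots,z_n)=\eta\, z_1^{\ell_1}\cdots z_n^{\ell_n}\,P(1/z_1,\dots,1/z_n).$$ Let $b_1,\dots,b_n>1$ be real, $\xi_j=\ln b_j$, $\xi\cdot k=\sum_j k_j\xi_j$, $F(s)=P(b_1^{-s},\dots,b_n^{-s})$ for $s\in\mathbb C$, and $L_+=\{\xi\cdot m: m\in\mathbb Z_{\ge0}^n\}\setminus\{0\}$. For $k\in\mathbb Z_{\ge 0}^n\setminus\{0\}$ let $c_P(k)$ be the coefficient of $z^k$ in the power series of $\log (P/P(0))$ at the origin; explicitly, if $P/P(0)=1+\sum_{m\ne0}a_P(m)z^m$, then $$c_P(k)=\sum_{\nu=1}^{k_1+\dots+k_n}\frac{(-1)^{\nu+1}}{\nu}\sum_{m_1+\dots+m_\nu=k}a_P(m_1)\cdots a_P(m_\nu).$$ Define $c_Q(k)$ likewise. For a Schwartz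 function $h$ put $\hat h(\gamma)=\int_{\mathbb R}h(t)e^{i\gamma t}\,dt$, and for a tempered distribution $T$ put $\hat T(h)=T(\hat h)$. Then all zeros of $F$ lie on the imaginary axis, and the positive measure $$\mu=\sum_{\gamma:\,F(i\gamma)=0}m(\gamma)\,\delta_\gamma,\qquad m(\gamma)=\text{the multiplicity of the zero } i\gamma \text{ of } F,$$ has the following properties. 1. $\mu$ is a (positive) crystalline measure: $\mu$ is a tempered distribution, and both $\mu=\sum_{\lambda\in\Lambda}a_\lambda\delta_\lambda$ and $\hat\mu=\sum_{s\in S}b_s\delta_s$ are sums of point masses over closed discrete sets $\Lambda,S\subset\mathbb R$. 2. $\mu$ is a Fourier quasicrystal: in addition, $|\mu|=\sum|a_\lambda|\delta_\lambda$ and $|\hat\mu|=\sum|b_s|\delta_s$ are tempered distributions. 3. For every Schwartz function $h$ on $\mathbb R$, $$\hat\mu(h)=\sum_{\gamma:\,F(i\gamma)=0}m(\gamma)\,\hat h(\gamma)=(\xi\cdot\ell)\,h(0)-\sum_{k\in\mathbb Z_{\ge0}^n\setminus\{0\}}(\xi\cdot k)\,c_P(k)\,h(\xi\cdot k)-\sum_{k\in\mathbb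 Z_{\ge0}^n\setminus\{0\}}(\xi\cdot k)\,c_Q(k)\,h(-\xi\cdot k),$$ all series being absolutely convergent, and $\hat\mu$ is supported in $L_+\cup(-L_+)\cup\{0\}$. 4. $\mu$ is an almost periodic measure: for every continuous compactly supported $\varphi:\mathbb R\to\mathbb C$ the function $x\mapsto\int\varphi(x-y)\,d\mu(y)$ is almost periodic in the sense of Bohr. -/

import Mathlib

open scoped SchwartzMap

namespace StableCrystalline

noncomputable section

/-! ### Stable pairs of polynomials -/

/-- `P` has no zero in the open unit polydisk. -/
def IsDStable {n : ℕ} (P : MvPolynomial (Fin n) ℂ) : Prop :=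
  ∀ z : Fin n → ℂ, (∀ j, ‖z j‖ < 1) → MvPolynomial.eval z P ≠ 0

/-- Both polynomials are stable, and `Q(z) = η z₁^ℓ₁ ⋯ zₙ^ℓₙ P(1/z₁, …, 1/zₙ)` as rational
functions. No normalization of the constant terms is required. -/
structure IsStablePair {n : ℕ} (P Q : MvPolynomial (Fin n) ℂ) (ℓ : Fin n → ℕ) (η : ℂ) : Prop where
  stable_left : IsDStable P
  stable_right : IsDStable Q
  functional_equation : ∀ z : Fin n → ℂ, (∀ j, z j ≠ 0) →
    MvPolynomial.eval z Q =
      η * (∏ j, z j ^ ℓ j) * MvPolynomial.eval (fun j => (z j)⁻¹) P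

/-- The coefficient `c_P(k)` of `z^k`, `k ≠ 0`, in the expansion at the origin of
`log P = log P(0) + log (P / P(0))`. With `P / P(0) = 1 + R` it equals the coefficient of `z^k` in
`∑_{ν ≥ 1} (-1)^(ν+1) R^ν / ν`; powers of `R` with `ν > k₁ + ⋯ + kₙ` do not contribute.
If `P(0) = 1`, this is the expansion of `log P`. The value at `k = 0` is `0`. -/
def logCoeff {n : ℕ} (P : MvPolynomial (Fin n) ℂ) (k : Fin n →₀ ℕ) : ℂ :=
  ∑ ν ∈ Finset.Icc 1 (∑ j, k j), (-1 : ℂ) ^ (ν + 1) / (ν : ℂ) *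
    MvPolynomial.coeff k
      ((MvPolynomial.C (MvPolynomial.coeff 0 P)⁻¹ * P - 1) ^ ν)

/-- The Dirichlet polynomial `F(s) = P(b₁^{-s}, …, bₙ^{-s})`. -/
def dirichletPoly {n : ℕ} (P : MvPolynomial (Fin n) ℂ) (b : Fin n → ℝ) (s : ℂ) : ℂ :=
  MvPolynomial.eval (fun j => (b j : ℂ) ^ (-s)) P

/-- The multiplicity of `iγ` as a zero of `F` (it is `0` when `F(iγ) ≠ 0`). -/
def zeroMult {n : ℕ} (P : MvPolynomial (Fin n) ℂ) (b : Fin n → ℝ) (γ : ℝ) : ℕ :=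
  analyticOrderNatAt (dirichletPoly P b) (Complex.I * (γ : ℂ))

/-- The support set `{γ ∈ ℝ : F(iγ) = 0}`. -/
def zeroSet {n : ℕ} (P : MvPolynomial (Fin n) ℂ) (b : Fin n → ℝ) : Set ℝ :=
  {γ | dirichletPoly P b (Complex.I * (γ : ℂ)) = 0}

/-- The sum of the delta masses at all real `γ` with `F(iγ) = 0`, counted with multiplicity. -/
def zeroMeasure {n : ℕ} (P : MvPolynomial (Fin n) ℂ) (b : Fin n → ℝ) : MeasureTheory.Measure ℝ :=
  MeasureTheory.Measure.sum fun γ : zeroSet P b =>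
    (zeroMult P b γ : ENNReal) • MeasureTheory.Measure.dirac (γ : ℝ)

/-- The pairing `ξ · k = k₁ log b₁ + ⋯ + kₙ log bₙ`. -/
def logDot {n : ℕ} (b : Fin n → ℝ) (k : Fin n → ℕ) : ℝ :=
  ∑ j, (k j : ℝ) * Real.log (b j)

/-- The additive semigroup `L₊` of all `ξ · m`, with `0` removed. -/
def Lplus {n : ℕ} (b : Fin n → ℝ) : Set ℝ :=
  {x | ∃ m : Fin n → ℕ, x = logDot b m} \ {0}

/-! ### The Fourier transform `ĥ(γ) = ∫ h(t) e^{iγt} dt` -/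

/-- The continuous linear map `h ↦ ĥ` on Schwartz functions, `ĥ(γ) = ∫ h(t) e^{iγt} dt`;
see `fourierS_apply`. -/
def fourierS : 𝓢(ℝ, ℂ) →L[ℂ] 𝓢(ℝ, ℂ) :=
  (SchwartzMap.compCLMOfContinuousLinearEquiv ℂ
    (ContinuousLinearEquiv.unitsEquivAut ℝ
      (Units.mk0 (2 * Real.pi)⁻¹ (inv_ne_zero Real.two_pi_pos.ne')))).comp
  (FourierTransform.fourierInvCLM ℂ 𝓢(ℝ, ℂ))

theorem fourierS_apply (h : 𝓢(ℝ, ℂ)) (γ : ℝ) :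
    fourierS h γ = ∫ t : ℝ, h t * Complex.exp (Complex.I * (γ : ℂ) * (t : ℂ)) := by
  have h1 : fourierS h γ = FourierTransformInv.fourierInv (h : ℝ → ℂ) (γ * (2 * Real.pi)⁻¹) := by
    rw [← SchwartzMap.fourierInv_coe]
    rfl
  rw [h1, Real.fourierInv_eq']
  refine MeasureTheory.integral_congr_ae (Filter.Eventually.of_forall fun t => ?_)
  have hpi : (Real.pi : ℂ) ≠ 0 := by exact_mod_cast Real.pi_ne_zero
  simp only [smul_eq_mul, RCLike.inner_apply, conj_trivial]
  rw [mul_comm]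
  congr 2
  push_cast
  field_simp

/-- The Fourier transform of a tempered distribution, `⟨T̂, h⟩ = ⟨T, ĥ⟩`. -/
def fourierT (T : 𝓢'(ℝ, ℂ)) : 𝓢'(ℝ, ℂ) :=
  PointwiseConvergenceCLM.precomp ℂ fourierS T

theorem fourierT_apply (T : 𝓢'(ℝ, ℂ)) (h : 𝓢(ℝ, ℂ)) : fourierT T h = T (fourierS h) := rfl

/-! ### Crystalline measures and Fourier quasicrystals -/

/-- The tempered distribution `T` equals `∑ a(x) δ_x`, where the set of all `x` with `a(x) ≠ 0` is
discrete and closed (every bounded interval contains only finitely many of them). As a compactly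
supported test function meets finitely many of the points, the sum over `x` is finite. -/
def IsDiscreteSum (T : 𝓢'(ℝ, ℂ)) (a : ℝ → ℂ) : Prop :=
  (∀ R : ℝ, (Function.support a ∩ Set.Icc (-R) R).Finite) ∧
  ∀ φ : 𝓢(ℝ, ℂ), HasCompactSupport φ → T φ = ∑ᶠ x : ℝ, a x * φ x

/-- A crystalline measure: a tempered distribution `∑ a_λ δ_λ` with Fourier transform
`∑ b_s δ_s`, both over discrete sets. -/
def IsCrystalline (T : 𝓢'(ℝ, ℂ)) : Prop :=
  ∃ a b : ℝ → ℂ, IsDiscreteSum T a ∧ IsDiscreteSum (fourierT T) b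

/-- A Fourier quasicrystal: a crystalline measure `μ` for which `|μ| = ∑ |a_λ| δ_λ` and
`|μ̂| = ∑ |b_s| δ_s` are tempered distributions as well. -/
def IsFourierQuasicrystal (T : 𝓢'(ℝ, ℂ)) : Prop :=
  ∃ a b : ℝ → ℂ, IsDiscreteSum T a ∧ IsDiscreteSum (fourierT T) b ∧
    (∃ T₁ : 𝓢'(ℝ, ℂ), IsDiscreteSum T₁ fun x => ((‖a x‖ : ℝ) : ℂ)) ∧
    (∃ T₂ : 𝓢'(ℝ, ℂ), IsDiscreteSum T₂ fun x => ((‖b x‖ : ℝ) : ℂ))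

/-! ### Almost periodicity -/

/-- Almost periodicity in the sense of Bohr: `f` is continuous and, for every `ε > 0`, the set of
its `ε`-almost periods meets every interval of some length `L`. -/
def IsBohrAlmostPeriodic (f : ℝ → ℂ) : Prop :=
  Continuous f ∧ ∀ ε : ℝ, 0 < ε → ∃ L : ℝ, 0 < L ∧ ∀ x : ℝ, ∃ τ ∈ Set.Icc x (x + L),
    ∀ t : ℝ, ‖f (t + τ) - f t‖ ≤ ε

/-- An almost periodic (Radon) measure: `φ * μ` is Bohr almost periodic for every continuous
function `φ` of compact support. -/
def IsAlmostPeriodicMeasure (μ : MeasureTheory.Measure ℝ) : Prop :=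
  MeasureTheory.IsLocallyFiniteMeasure μ ∧
  ∀ φ : ℝ → ℂ, Continuous φ → HasCompactSupport φ →
    IsBohrAlmostPeriodic fun x => ∫ y, φ (x - y) ∂μ

end

end StableCrystalline

open StableCrystalline

/-! For `Re s > 0` the point `(b_j^{-s})` lies in the open polydisk, so `F(s) ≠ 0`. The functional
equation reads `F_Q(s) = η e^{-(ξ·ℓ)s} F(-s)`, with `F_Q` the Dirichlet polynomial of `Q`; stability
of `Q` then excludes zeros with `Re s < 0`.

The summation formula comes from computing the jump of `F'/F` between `-σ + it` and `σ + it` in two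
ways as `σ → 0+`. Locally `F'/F` is a sum of simple poles on the axis plus an analytic function;
each pole contributes a Poisson kernel and the analytic part cancels, so the jump tends to `2πμ`
(`tendsto_integral_mul_logDerivJump`). On the other hand `-F'/F = ∑ (ξ·k) c_P(k) e^{-(ξ·k)s}` on the
right, and the functional equation gives the expansion on the left in terms of `Q`; the jump is thus
an exponential series with the claimed masses, damped by `e^{-|λ|σ}`
(`hasSum_spectral_logDerivJump`). Pairing with a compactly supported smooth function and removing
the damping gives the formula for such functions, and density extends it to Schwartz functions.

Convergence rests on `|k| |c_P(k)| ≤ deg P` (`IsDStable.norm_logCoeff_le`). On a line `t ↦ tw` with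
`w` in the unit torus, `P` becomes a one-variable polynomial whose roots have modulus at least 1, so
the coefficients of its logarithmic derivative are bounded by the degree; Fourier coefficients on
the torus then recover the individual `c_P(k)`. Hence the masses `(ξ·k) c_P(k)` are bounded, while
the points `ξ·k` grow at least linearly in each `k_j`.

Translating a test function changes its transform only by phases. The formula therefore bounds the
number of zeros in an interval by its length alone, which makes `μ` tempered, and it exhibits `φ *
μ` for smooth `φ` as an absolutely convergent trigonometric series, which gives almost periodicity.
-/

namespace StableCrystalline

/-! ### Logarithmic derivatives of one-variable polynomials without zeros in the unit disk -/

section OneVariable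

open Polynomial

/-- Here `V` is the expansion of `X p'/p = ∑ X/(X - ρ)`. Each summand is `-∑_{m ≥ 1} ρ^{-m} X^m`,
with coefficients of modulus at most 1, so every root costs at most 1. -/
lemma exists_bounded_logDeriv_of_roots (s : Multiset ℂ) (hs : ∀ ρ ∈ s, 1 ≤ ‖ρ‖) :
    ∃ V : PowerSeries ℂ,
      (((s.map fun ρ => X - C ρ).prod : Polynomial ℂ) : PowerSeries ℂ) * V =
        ((X * derivative (s.map fun ρ => X - C ρ).prod : Polynomial ℂ) : PowerSeries ℂ) ∧
      ∀ m, ‖PowerSeries.coeff m V‖ ≤ s.card := by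
  induction s using Multiset.induction with
  | empty => exact ⟨0, by simp, by simp⟩
  | cons ρ s ih =>
    obtain ⟨V, hV, hVb⟩ := ih fun r hr => hs r (Multiset.mem_cons_of_mem hr)
    have hρ : 1 ≤ ‖ρ‖ := hs ρ (Multiset.mem_cons_self _ _)
    have hρ0 : ρ ≠ 0 := fun h => by simp [h] at hρ; linarith
    set W : PowerSeries ℂ := PowerSeries.X * PowerSeries.mk fun m => -(ρ⁻¹) ^ (m + 1) with hW
    have hW1 : (PowerSeries.X - PowerSeries.C ρ) * W = PowerSeries.X := by
      rw [hW, mul_left_comm]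
      conv_rhs => rw [← mul_one PowerSeries.X]
      congr 1
      ext m
      rw [sub_mul, map_sub, PowerSeries.coeff_C_mul, PowerSeries.coeff_mk, PowerSeries.coeff_one]
      cases m with
      | zero => simp [hρ0]
      | succ m =>
        rw [PowerSeries.coeff_succ_X_mul, PowerSeries.coeff_mk, pow_succ' _ (m + 1)]
        field_simp
        simp
    refine ⟨V + W, ?_, fun m => ?_⟩
    · rw [Multiset.map_cons, Multiset.prod_cons, derivative_mul]
      simp only [derivative_sub, derivative_X, derivative_C, sub_zero, one_mul]
      push_cast at hV ⊢
      rw [mul_add, mul_assoc, hV, mul_right_comm, hW1]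
      ring
    · rw [map_add, Multiset.card_cons, Nat.cast_add, Nat.cast_one]
      refine (norm_add_le _ _).trans (add_le_add (hVb m) ?_)
      cases m with
      | zero => simp [hW]
      | succ m =>
        rw [hW, PowerSeries.coeff_succ_X_mul, PowerSeries.coeff_mk, norm_neg, norm_pow, norm_inv]
        exact pow_le_one₀ (by positivity) (inv_le_one_of_one_le₀ hρ)

lemma exists_bounded_logDeriv {p : Polynomial ℂ} 
    (hp : ∀ t : ℂ, ‖t‖ < 1 → p.eval t ≠ 0) :
    ∃ V : PowerSeries ℂ,
      (p : PowerSeries ℂ) * V = ((X * derivative p : Polynomial ℂ) : PowerSeries ℂ) ∧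
      ∀ m, ‖PowerSeries.coeff m V‖ ≤ p.natDegree := by
  have hs : p.Splits := IsAlgClosed.splits p
  obtain ⟨V, hV, hVb⟩ := exists_bounded_logDeriv_of_roots p.roots fun ρ hρ => by
    by_contra h
    exact hp ρ (not_le.mp h) (isRoot_of_mem_roots hρ)
  refine ⟨V, ?_, fun m => (hVb m).trans (by exact_mod_cast p.card_roots')⟩
  have h := hs.eq_prod_roots
  generalize p.leadingCoeff = a at h
  generalize p.roots = r at h hV
  rw [h, derivative_C_mul, mul_left_comm, Polynomial.coe_mul, mul_assoc, hV,
    Polynomial.coe_mul (C a)]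

end OneVariable

open MvPolynomial

/-! ### The coefficients of the logarithm of a stable polynomial -/

/-- The derivation `∑ ξ_j z_j ∂/∂z_j` of the polynomial ring. -/
noncomputable def weightedEuler {n : ℕ} (ξ : Fin n → ℂ) :
    Derivation ℂ (MvPolynomial (Fin n) ℂ) (MvPolynomial (Fin n) ℂ) :=
  mkDerivation ℂ fun j => C (ξ j) * X j

lemma coeff_weightedEuler {n : ℕ} (ξ : Fin n → ℂ) (f : MvPolynomial (Fin n) ℂ)
    (k : Fin n →₀ ℕ) :
    coeff k (weightedEuler ξ f) = (∑ j, (k j : ℂ) * ξ j) * coeff k f := by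
  induction f using MvPolynomial.induction_on' with
  | add p q hp hq => rw [map_add, coeff_add, coeff_add, hp, hq, mul_add]
  | monomial s a =>
    have h : weightedEuler ξ (monomial s a) = monomial s ((∑ j, (s j : ℂ) * ξ j) * a) := by
      rw [weightedEuler, mkDerivation_monomial, Finsupp.sum_fintype _ _ (by simp),
        Finset.sum_mul, map_sum, Finset.smul_sum]
      refine Finset.sum_congr rfl fun i _ => ?_
      by_cases hi : s i = 0
      · simp [hi]
      · rw [smul_eq_mul, mul_comm (C (ξ i)), ← mul_assoc, X, monomial_mul,
          tsub_add_cancel_of_le (by simpa using Nat.one_le_iff_ne_zero.mpr hi), mul_comm,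
          C_mul_monomial, smul_monomial]
        congr 1
        simp only [smul_eq_mul]
        ring
    rw [h, coeff_monomial, coeff_monomial]
    split_ifs with hs
    · rw [hs]
    · simp

/-- A power `R^ν` of a polynomial without constant term starts in degree `ν`; this is why the
truncated sum in `logCoeff` loses nothing. -/
lemma coeff_pow_eq_zero_of_degree_lt {n : ℕ} {R : MvPolynomial (Fin n) ℂ} (hR : coeff 0 R = 0)
    {k : Fin n →₀ ℕ} {ν : ℕ} (h : ∑ j, k j < ν) : coeff k (R ^ ν) = 0 := by
  rw [← coeff_coe, coe_pow]
  refine MvPowerSeries.coeff_eq_zero_of_constantCoeff_nilpotent (m := 1) ?_ ?_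
  · rw [pow_one, ← MvPowerSeries.coeff_zero_eq_constantCoeff_apply, coeff_coe, hR]
  · rw [Finsupp.degree_eq_sum]
    omega

/-- `P / P(0) - 1` -/
noncomputable def normalizedTail {n : ℕ} (P : MvPolynomial (Fin n) ℂ) : MvPolynomial (Fin n) ℂ :=
  C (coeff 0 P)⁻¹ * P - 1

lemma coeff_zero_normalizedTail {n : ℕ} {P : MvPolynomial (Fin n) ℂ} (hP : coeff 0 P ≠ 0) :
    coeff 0 (normalizedTail P) = 0 := by
  simp [normalizedTail, coeff_C_mul, hP]

/-- A truncation of the power series of `(D P) / P`, with `D = weightedEuler ξ`. -/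
noncomputable def logDerivTrunc {n : ℕ} (ξ : Fin n → ℂ) (P : MvPolynomial (Fin n) ℂ) (M : ℕ) :
    MvPolynomial (Fin n) ℂ :=
  ∑ ν ∈ Finset.range M, (-normalizedTail P) ^ ν * weightedEuler ξ (normalizedTail P)

/-- The Leibniz rule `D(R^{ν+1}) = (ν+1) R^ν D R`, read on coefficients, where `D` acts diagonally.
-/
lemma coeff_pow_mul_weightedEuler {n : ℕ} (ξ : Fin n → ℂ) (R : MvPolynomial (Fin n) ℂ)
    (k : Fin n →₀ ℕ) (ν : ℕ) :
    (ν + 1 : ℂ) * coeff k (R ^ ν * weightedEuler ξ R) =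
      (∑ j, (k j : ℂ) * ξ j) * coeff k (R ^ (ν + 1)) := by
  rw [← coeff_weightedEuler, Derivation.leibniz_pow, Nat.add_sub_cancel, smul_eq_mul, coeff_smul,
    nsmul_eq_mul]
  push_cast
  rfl

/-- With `R = P/P(0) - 1`, the sum `∑ (-R)^ν D R` is `D` applied to a truncation of `∑ (-1)^{ν+1}
R^ν / ν`, and terms with `ν > |k|` do not reach `k`. -/
lemma coeff_logDerivTrunc {n : ℕ} (ξ : Fin n → ℂ) {P : MvPolynomial (Fin n) ℂ}
    (hP : coeff 0 P ≠ 0) {k : Fin n →₀ ℕ} {M : ℕ} (hk : ∑ j, k j ≤ M) :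
    coeff k (logDerivTrunc ξ P M) = (∑ j, (k j : ℂ) * ξ j) * logCoeff P k := by
  have h0 := coeff_zero_normalizedTail hP
  have h1 : logCoeff P k = ∑ ν ∈ Finset.Icc 1 M, (-1 : ℂ) ^ (ν + 1) / (ν : ℂ) *
      coeff k (normalizedTail P ^ ν) := by
    refine Finset.sum_subset (Finset.Icc_subset_Icc_right hk) fun ν hν hν' => ?_
    rw [Finset.mem_Icc] at hν hν'
    have : ∑ j, k j < ν := by omega
    exact mul_eq_zero_of_right _ (coeff_pow_eq_zero_of_degree_lt h0 this)
  rw [h1, logDerivTrunc, coeff_sum, Finset.mul_sum, ← Finset.Ico_add_one_right_eq_Icc,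
    Finset.sum_Ico_eq_sum_range]
  refine Finset.sum_congr rfl fun ν _ => ?_
  have h2 := coeff_pow_mul_weightedEuler ξ (normalizedTail P) k ν
  have h3 : (ν + 1 : ℂ) ≠ 0 := by exact_mod_cast Nat.succ_ne_zero ν
  rw [neg_pow, mul_assoc, show ((-1 : MvPolynomial (Fin n) ℂ) ^ ν) = C ((-1) ^ ν) by simp,
    coeff_C_mul, add_comm 1 ν]
  push_cast
  rw [mul_left_comm, ← h2]
  field_simp
  ring

lemma one_add_mul_logDerivTrunc {n : ℕ} (ξ : Fin n → ℂ) (P : MvPolynomial (Fin n) ℂ) (M : ℕ) :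
    C (coeff 0 P)⁻¹ * P * logDerivTrunc ξ P M =
      (1 - (-normalizedTail P) ^ M) * weightedEuler ξ (normalizedTail P) := by
  have h : C (coeff 0 P)⁻¹ * P = 1 - (-normalizedTail P) := by simp [normalizedTail]
  rw [logDerivTrunc, ← Finset.sum_mul, ← mul_assoc, h, mul_neg_geom_sum]

/-- The power series identity `P · (D log P) = D P`, where `D = ∑ ξ_j z_j ∂/∂z_j`. -/
lemma sum_antidiagonal_logCoeff {n : ℕ} (ξ : Fin n → ℂ) {P : MvPolynomial (Fin n) ℂ}
    (hP : coeff 0 P ≠ 0) (k : Fin n →₀ ℕ) :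
    ∑ p ∈ Finset.HasAntidiagonal.antidiagonal k,
        coeff p.1 P * ((∑ j, (p.2 j : ℂ) * ξ j) * logCoeff P p.2) =
      (∑ j, (k j : ℂ) * ξ j) * coeff k P := by
  set M := ∑ j, k j with hM
  have h1 : ∑ p ∈ Finset.HasAntidiagonal.antidiagonal k,
      coeff p.1 P * ((∑ j, (p.2 j : ℂ) * ξ j) * logCoeff P p.2) =
      coeff k (P * logDerivTrunc ξ P M) := by
    rw [coeff_mul]
    refine Finset.sum_congr rfl fun p hp => ?_
    rw [coeff_logDerivTrunc ξ hP]
    rw [← Finset.HasAntidiagonal.mem_antidiagonal.mp hp] at hM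
    rw [hM]
    exact Finset.sum_le_sum fun j _ => by simp
  have h2 := congrArg (coeff k) (one_add_mul_logDerivTrunc ξ P M)
  have h0 := coeff_zero_normalizedTail hP
  -- The error of the truncated geometric sum has order at least `M + 1`, since it is
  -- `D(R^{M+1})/(M+1)` up to sign, whereas `k` has degree `M`.
  have h3 : coeff k ((-normalizedTail P) ^ M * weightedEuler ξ (normalizedTail P)) = 0 := by
    have h4 := coeff_pow_mul_weightedEuler ξ (normalizedTail P) k M
    rw [coeff_pow_eq_zero_of_degree_lt h0 (Nat.lt_succ_of_le le_rfl), mul_zero,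
      mul_eq_zero, or_iff_right (by exact_mod_cast Nat.succ_ne_zero M)] at h4
    rw [neg_pow, mul_assoc, show ((-1 : MvPolynomial (Fin n) ℂ) ^ M) = C ((-1) ^ M) by simp,
      coeff_C_mul, h4, mul_zero]
  rw [sub_mul, one_mul, coeff_sub, h3, sub_zero, mul_assoc, coeff_C_mul, coeff_weightedEuler] at h2
  rw [h1]
  -- `R` and `P/P(0)` differ only in the constant term, and at `k = 0` the weight `ξ·k` vanishes on
  -- both sides.
  by_cases hk : k = 0
  · subst hk
    simp only [Finsupp.coe_zero, Pi.zero_apply, Nat.cast_zero, zero_mul,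
      Finset.sum_const_zero] at h2 ⊢
    simpa [hP] using h2
  · have h5 : coeff k (normalizedTail P) = (coeff 0 P)⁻¹ * coeff k P := by
      rw [normalizedTail, coeff_sub, coeff_C_mul, coeff_one, if_neg (Ne.symm hk), sub_zero]
    rw [h5, mul_left_comm] at h2
    exact mul_left_cancel₀ (inv_ne_zero hP) h2

/-! ### Bounds for the coefficients -/

/-- Restriction of a polynomial to the line `t ↦ t • w`. -/
noncomputable def restrictLine {n : ℕ} (w : Fin n → ℂ) :
    MvPolynomial (Fin n) ℂ →ₐ[ℂ] Polynomial ℂ :=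
  aeval fun j => Polynomial.C (w j) * Polynomial.X

/-- Converts one-variable coefficient bounds, uniform in `w`, into bounds for homogeneous components
on the torus. -/
lemma coeff_restrictLine {n : ℕ} (w : Fin n → ℂ) (f : MvPolynomial (Fin n) ℂ) (m : ℕ) :
    (restrictLine w f).coeff m = eval w (homogeneousComponent m f) := by
  induction f using MvPolynomial.induction_on' with
  | add p q hp hq => rw [map_add, Polynomial.coeff_add, hp, hq, map_add, map_add]
  | monomial s a =>
    have h1 : restrictLine w (monomial s a) =
        Polynomial.C (a * ∏ j, w j ^ s j) * Polynomial.X ^ (∑ j, s j) := by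
      rw [restrictLine, aeval_monomial, Finsupp.prod_fintype _ _ (by simp)]
      simp only [mul_pow, Finset.prod_mul_distrib, Finset.prod_pow_eq_pow_sum, map_mul, map_prod,
        map_pow, Polynomial.algebraMap_eq]
      ring
    rw [h1, Polynomial.coeff_C_mul_X_pow]
    split_ifs with h
    · rw [homogeneousComponent_of_mem (isHomogeneous_monomial (n := m) a
        (by rw [Finsupp.degree_eq_sum, h])), if_pos rfl, eval_monomial,
        Finsupp.prod_fintype _ _ (by simp)]
    · rw [homogeneousComponent_of_mem (isHomogeneous_monomial (n := ∑ j, s j) a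
        (by rw [Finsupp.degree_eq_sum])), if_neg h, map_zero]

lemma eval_restrictLine {n : ℕ} (w : Fin n → ℂ) (f : MvPolynomial (Fin n) ℂ) (t : ℂ) :
    (restrictLine w f).eval t = eval (fun j => t * w j) f := by
  induction f using MvPolynomial.induction_on with
  | C a => simp [restrictLine]
  | add p q hp hq => simp [hp, hq]
  | mul_X p j hp => rw [map_mul, Polynomial.eval_mul, hp, map_mul, eval_X, restrictLine, aeval_X,
      Polynomial.eval_mul, Polynomial.eval_C, Polynomial.eval_X, mul_comm t]

lemma natDegree_restrictLine_le {n : ℕ} (w : Fin n → ℂ) (f : MvPolynomial (Fin n) ℂ) :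
    (restrictLine w f).natDegree ≤ f.totalDegree := by
  rw [Polynomial.natDegree_le_iff_coeff_eq_zero]
  intro m hm
  rw [coeff_restrictLine, homogeneousComponent_eq_zero _ _ hm, map_zero]

/-- With all weights 1, `D` is the radial Euler field, hence tangent to lines through the origin. -/
lemma restrictLine_weightedEuler {n : ℕ} (w : Fin n → ℂ) (f : MvPolynomial (Fin n) ℂ) :
    restrictLine w (weightedEuler (fun _ => 1) f) =
      Polynomial.X * Polynomial.derivative (restrictLine w f) := by
  induction f using MvPolynomial.induction_on with
  | C a => simp [restrictLine, weightedEuler]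
  | add p q hp hq => simp only [map_add, hp, hq, mul_add]
  | mul_X p j hp =>
    rw [Derivation.leibniz, map_mul, map_add, smul_eq_mul, smul_eq_mul, map_mul, map_mul, hp,
      Polynomial.derivative_mul]
    simp [restrictLine, weightedEuler, mkDerivation_X]
    ring

/-- A coefficient of a polynomial is at most its supremum on the unit torus. -/
lemma norm_coeff_le_of_forall_torus {n : ℕ} (W : MvPolynomial (Fin n) ℂ) {N : ℝ}
    (h : ∀ w : Fin n → ℂ, (∀ j, ‖w j‖ = 1) → ‖eval w W‖ ≤ N) (k : Fin n →₀ ℕ) :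
    ‖coeff k W‖ ≤ N := by
  -- Haar probability measure on the torus: orthogonality of characters expresses each coefficient
  -- as an average of `W` against a unimodular function.
  obtain ⟨μ, hμ, horth⟩ : ∃ μ : MeasureTheory.Measure (UnitAddTorus (Fin n)),
      MeasureTheory.IsProbabilityMeasure μ ∧ ∀ a b : Fin n → ℤ,
        ∫ t, UnitAddTorus.mFourier (-a) t * UnitAddTorus.mFourier b t ∂μ =
          if a = b then 1 else 0 := by
    refine ⟨MeasureTheory.Measure.pi fun _ => AddCircle.haarAddCircle, inferInstance,
      fun a b => ?_⟩
    have h := orthonormal_iff_ite.mp (UnitAddTorus.orthonormal_mFourier (d := Fin n)) a b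
    rw [MeasureTheory.ContinuousMap.inner_toLp] at h
    rw [← h]
    simp only [UnitAddTorus.mFourier_neg]
    simp only [mul_comm]
    rfl
  set e : (Fin n →₀ ℕ) → (Fin n → ℤ) := fun s j => (s j : ℤ) with he
  have hev : ∀ t : UnitAddTorus (Fin n), eval (fun j => (fourier 1 (t j) : ℂ)) W =
      ∑ s ∈ W.support, coeff s W * UnitAddTorus.mFourier (e s) t := by
    intro t
    rw [eval_eq']
    refine Finset.sum_congr rfl fun s _ => ?_
    congr 1
    refine Finset.prod_congr rfl fun j _ => ?_
    simp [he, fourier_apply, AddCircle.toCircle_nsmul]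
  have hint : ∫ t, UnitAddTorus.mFourier (-(e k)) t *
      eval (fun j => (fourier 1 (t j) : ℂ)) W ∂μ = coeff k W := by
    simp only [hev, Finset.mul_sum]
    rw [MeasureTheory.integral_finsetSum]
    · simp only [mul_left_comm _ (coeff _ W), MeasureTheory.integral_const_mul, horth]
      have hinj : ∀ s, (e k = e s) ↔ k = s := fun s => by
        simp [he, _root_.funext_iff, DFunLike.ext_iff]
      simp only [hinj, mul_ite, mul_one, mul_zero, Finset.sum_ite_eq]
      split_ifs with hk
      · rfl
      · exact (notMem_support_iff.mp hk).symm
    · intro s _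
      refine Continuous.integrable_of_hasCompactSupport ?_
        (HasCompactSupport.of_compactSpace _)
      fun_prop
  rw [← hint]
  refine (MeasureTheory.norm_integral_le_of_norm_le_const (C := N)
    (Filter.Eventually.of_forall fun t => ?_)).trans (by simp)
  rw [norm_mul]
  have h1 : ‖UnitAddTorus.mFourier (-(e k)) t‖ ≤ 1 := by
    exact (ContinuousMap.norm_coe_le_norm _ t).trans UnitAddTorus.mFourier_norm.le
  have h2 := h (fun j => (fourier 1 (t j) : ℂ)) fun j => by
    rw [fourier_apply]
    exact Circle.norm_coe _
  calc _ ≤ 1 * N := mul_le_mul h1 h2 (norm_nonneg _) zero_le_one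
    _ = N := one_mul N

lemma IsDStable.coeff_zero_ne {n : ℕ} {P : MvPolynomial (Fin n) ℂ} (hP : IsDStable P) :
    coeff 0 P ≠ 0 := by
  have h := hP 0 (by simp)
  rwa [← constantCoeff_eq, ← eval_zero]

/-- For a stable polynomial, `c_P(k) = O(1 / |k|)`. -/
lemma IsDStable.norm_logCoeff_le {n : ℕ} {P : MvPolynomial (Fin n) ℂ} (hP : IsDStable P)
    (k : Fin n →₀ ℕ) : ((∑ j, k j : ℕ) : ℝ) * ‖logCoeff P k‖ ≤ P.totalDegree := by
  have h0 := hP.coeff_zero_ne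
  set m := ∑ j, k j with hm
  -- The length `m + 1` keeps degree `m` exact and makes the error on every line divisible by
  -- `X^{m+1}`.
  set U := logDerivTrunc (fun _ => 1) P (m + 1) with hU
  have hk : coeff k (homogeneousComponent m U) = (m : ℂ) * logCoeff P k := by
    rw [coeff_homogeneousComponent, if_pos (by rw [Finsupp.degree_eq_sum]), hU,
      coeff_logDerivTrunc _ h0 (by omega), hm]
    simp
  have hb : ‖coeff k (homogeneousComponent m U)‖ ≤ P.totalDegree := by
    refine norm_coeff_le_of_forall_torus _ (fun w hw => ?_) k
    rw [← coeff_restrictLine]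
    set p := restrictLine w (C (coeff 0 P)⁻¹ * P) with hp
    have hpe : ∀ t : ℂ, ‖t‖ < 1 → p.eval t ≠ 0 := fun t ht => by
      rw [hp, eval_restrictLine, map_mul, eval_C]
      refine mul_ne_zero (inv_ne_zero h0) (hP _ fun j => ?_)
      rw [norm_mul, hw, mul_one]
      exact ht
    obtain ⟨V, hV, hVb⟩ := exists_bounded_logDeriv hpe
    have hdeg : p.natDegree ≤ P.totalDegree :=
      (natDegree_restrictLine_le _ _).trans ((totalDegree_mul _ _).trans (by simp))
    have hRX : Polynomial.X ∣ restrictLine w (-normalizedTail P) := by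
      rw [Polynomial.X_dvd_iff, coeff_restrictLine, homogeneousComponent_zero, eval_C, coeff_neg,
        coeff_zero_normalizedTail h0, neg_zero]
    have hder : restrictLine w (weightedEuler (fun _ => 1) (normalizedTail P)) =
        Polynomial.X * Polynomial.derivative p := by
      rw [restrictLine_weightedEuler, normalizedTail, map_sub, ← hp]
      simp
    have key := congrArg (restrictLine w) (one_add_mul_logDerivTrunc (fun _ => 1) P (m + 1))
    rw [map_mul, ← hp, ← hU, map_mul, hder, map_sub, map_one, map_pow] at key
    obtain ⟨S, hS⟩ := pow_dvd_pow_of_dvd hRX (m + 1)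
    have hdvd : (PowerSeries.X : PowerSeries ℂ) ^ (m + 1) ∣
        (p : PowerSeries ℂ) * (V - (restrictLine w U : Polynomial ℂ)) := by
      refine ⟨(S * (Polynomial.X * Polynomial.derivative p) : Polynomial ℂ), ?_⟩
      rw [mul_sub, hV, ← Polynomial.coe_mul, key, hS]
      push_cast
      ring
    -- Since `p(0) ≠ 0`, the factor `p` can be cancelled modulo `X^{m+1}`; so `V` and the
    -- restriction of `U` have the same coefficient in degree `m`.
    have hpX : ¬ PowerSeries.X ∣ (p : PowerSeries ℂ) := by
      rw [PowerSeries.X_dvd_iff, Polynomial.constantCoeff_coe]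
      simpa [Polynomial.coeff_zero_eq_eval_zero] using hpe 0 (by simp)
    have h1 := PowerSeries.X_pow_dvd_iff.mp
      (PowerSeries.X_prime.pow_dvd_of_dvd_mul_left _ hpX hdvd) m (Nat.lt_succ_self m)
    rw [map_sub, Polynomial.coeff_coe, sub_eq_zero] at h1
    rw [← h1]
    exact (hVb m).trans (by exact_mod_cast hdeg)
  rw [hk, norm_mul, Complex.norm_natCast] at hb
  exact hb

end StableCrystalline

namespace StableCrystalline

open Filter Topology

/-! ### Summation over the semigroup -/

/-- A finite index set lies in the box of its projections, over which the sum of products factors.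
-/
lemma summable_prod_apply {n : ℕ} {f : ℕ → ℝ} (hf : Summable f) (h0 : ∀ m, 0 ≤ f m) :
    Summable fun k : Fin n → ℕ => ∏ j, f (k j) := by
  refine summable_of_sum_le (c := ∏ _j : Fin n, ∑' m, f m)
    (fun k => Finset.prod_nonneg fun j _ => h0 _) fun s => ?_
  calc ∑ k ∈ s, ∏ j, f (k j)
      ≤ ∑ k ∈ Fintype.piFinset fun j => s.image fun k => k j, ∏ j, f (k j) := by
        refine Finset.sum_le_sum_of_subset_of_nonneg (fun k hk => ?_)
          fun k _ _ => Finset.prod_nonneg fun j _ => h0 _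
        exact Fintype.mem_piFinset.mpr fun j => Finset.mem_image_of_mem _ hk
    _ = ∏ j : Fin n, ∑ m ∈ s.image fun k => k j, f m := by rw [Finset.prod_univ_sum]
    _ ≤ ∏ _j : Fin n, ∑' m, f m := by
        refine Finset.prod_le_prod (fun j _ => Finset.sum_nonneg fun m _ => h0 m) fun j _ => ?_
        exact hf.sum_le_tsum _ fun m _ => h0 m

lemma logDot_nonneg {n : ℕ} {b : Fin n → ℝ} (hb : ∀ j, 1 < b j) (k : Fin n → ℕ) :
    0 ≤ logDot b k :=
  Finset.sum_nonneg fun j _ => mul_nonneg (Nat.cast_nonneg _) (Real.log_nonneg (hb j).le)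

lemma exists_mul_one_add_le_one_add_logDot {n : ℕ} {b : Fin n → ℝ} (hb : ∀ j, 1 < b j) :
    ∃ c : ℝ, 0 < c ∧ ∀ (k : Fin n → ℕ) (j : Fin n), c * (1 + k j) ≤ 1 + logDot b k := by
  obtain ⟨c, hc0, hc1, hc⟩ : ∃ c : ℝ, 0 < c ∧ c ≤ 1 ∧ ∀ j, c ≤ Real.log (b j) := by
    have hlog : ∀ j, 0 < (Real.log (b j))⁻¹ := fun j => inv_pos.mpr (Real.log_pos (hb j))
    have hsum : 0 ≤ ∑ j, (Real.log (b j))⁻¹ := Finset.sum_nonneg fun j _ => (hlog j).le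
    -- This constant lies below 1 and below every `log b_j`, and it makes sense for `n = 0` too.
    refine ⟨(1 + ∑ j, (Real.log (b j))⁻¹)⁻¹, by positivity,
      inv_le_one_of_one_le₀ (by linarith), fun j => ?_⟩
    rw [inv_le_comm₀ (by positivity) (Real.log_pos (hb j))]
    have := Finset.single_le_sum (f := fun j => (Real.log (b j))⁻¹) (fun j _ => (hlog j).le)
      (Finset.mem_univ j)
    linarith
  refine ⟨c, hc0, fun k j => ?_⟩
  have h1 : (k j : ℝ) * Real.log (b j) ≤ logDot b k :=
    Finset.single_le_sum (f := fun j => (k j : ℝ) * Real.log (b j))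
      (fun j _ => mul_nonneg (Nat.cast_nonneg _) (Real.log_nonneg (hb j).le)) (Finset.mem_univ j)
  have h2 : c * (k j : ℝ) ≤ k j * Real.log (b j) := by
    rw [mul_comm]
    exact mul_le_mul_of_nonneg_left (hc j) (Nat.cast_nonneg _)
  linarith

lemma summable_nat_one_add_sq : Summable fun m : ℕ => ((1 + (m : ℝ)) ^ 2)⁻¹ := by
  have := (summable_nat_add_iff 1).mpr (Real.summable_nat_pow_inv (p := 2).mpr (by norm_num))
  refine this.congr fun m => ?_
  push_cast
  rw [add_comm]

/-- The exponent `2 * n` lets each of the `n` coordinates absorb two powers of `1 + ξ·k`, which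
dominate a multiple of `(1 + k_j)^2`. -/
lemma summable_one_add_logDot {n : ℕ} {b : Fin n → ℝ} (hb : ∀ j, 1 < b j) :
    Summable fun k : Fin n →₀ ℕ => ((1 + logDot b k) ^ (2 * n))⁻¹ := by
  obtain ⟨c, hc, hck⟩ := exists_mul_one_add_le_one_add_logDot hb
  have h1 := summable_nat_one_add_sq
  have h2 := (summable_prod_apply (n := n) h1 fun m => by positivity).mul_left
    ((c ^ 2)⁻¹ ^ n)
  have h3 : Summable fun k : Fin n → ℕ => ((1 + logDot b k) ^ (2 * n))⁻¹ := by
    refine Summable.of_nonneg_of_le (fun k => ?_) (fun k => ?_) h2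
    · have := logDot_nonneg hb k
      positivity
    · rw [inv_pow, Finset.prod_inv_distrib, ← mul_inv]
      refine inv_anti₀ (by positivity) ?_
      calc (c ^ 2) ^ n * ∏ j, (1 + (k j : ℝ)) ^ 2 = ∏ j, (c * (1 + (k j : ℝ))) ^ 2 := by
            simp [mul_pow, Finset.prod_mul_distrib]
        _ ≤ ∏ _j : Fin n, (1 + logDot b k) ^ 2 :=
            Finset.prod_le_prod (fun j _ => by positivity)
              fun j _ => pow_le_pow_left₀ (by positivity) (hck k j) 2
        _ = (1 + logDot b k) ^ (2 * n) := by simp [pow_mul]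
  exact (Finsupp.equivFunOnFinite.summable_iff
    (f := fun k : Fin n → ℕ => ((1 + logDot b k) ^ (2 * n))⁻¹)).mpr h3

lemma finite_logDot_le {n : ℕ} {b : Fin n → ℝ} (hb : ∀ j, 1 < b j) (R : ℝ) :
    {k : Fin n →₀ ℕ | logDot b k ≤ R}.Finite := by
  obtain ⟨c, hc, hck⟩ := exists_mul_one_add_le_one_add_logDot hb
  have h : (Set.Iic (fun _ : Fin n => ⌈(1 + R) / c⌉₊)).Finite := Set.finite_Iic _
  refine (h.preimage (f := fun k : Fin n →₀ ℕ => (k : Fin n → ℕ))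
    (DFunLike.coe_injective.injOn)).subset fun k hk => ?_
  intro j
  have h1 := (hck k j).trans (add_le_add_right hk 1)
  have h2 : (k j : ℝ) ≤ (1 + R) / c := by
    rw [le_div_iff₀ hc]
    nlinarith
  exact_mod_cast h2.trans (Nat.le_ceil _)

lemma logDot_add {n : ℕ} (b : Fin n → ℝ) (k m : Fin n → ℕ) :
    logDot b (k + m) = logDot b k + logDot b m := by
  simp [logDot, add_mul, Finset.sum_add_distrib]

lemma ofReal_logDot {n : ℕ} (b : Fin n → ℝ) (k : Fin n → ℕ) :
    (logDot b k : ℂ) = ∑ j, (k j : ℂ) * (Real.log (b j) : ℂ) := by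
  simp [logDot]

/-- The decay `c_P(k) = O(1/|k|)` exactly offsets the growth `ξ·k ≤ (∑ log b_j) |k|`. -/
lemma exists_norm_logDot_mul_logCoeff_le {n : ℕ} {P : MvPolynomial (Fin n) ℂ} (hP : IsDStable P)
    {b : Fin n → ℝ} (hb : ∀ j, 1 < b j) :
    ∃ C : ℝ, 0 ≤ C ∧ ∀ k : Fin n →₀ ℕ, ‖(logDot b k : ℂ) * logCoeff P k‖ ≤ C := by
  have hl : ∀ j, 0 ≤ Real.log (b j) := fun j => Real.log_nonneg (hb j).le
  have hS : 0 ≤ ∑ j, Real.log (b j) := Finset.sum_nonneg fun j _ => hl j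
  refine ⟨(∑ j, Real.log (b j)) * P.totalDegree, by positivity, fun k => ?_⟩
  have h1 : logDot b k ≤ (∑ j, Real.log (b j)) * ((∑ j, k j : ℕ) : ℝ) := by
    rw [logDot, Finset.sum_mul]
    refine Finset.sum_le_sum fun j _ => ?_
    rw [mul_comm]
    refine mul_le_mul_of_nonneg_left ?_ (hl j)
    exact_mod_cast Finset.single_le_sum (f := fun j => k j) (fun _ _ => Nat.zero_le _)
      (Finset.mem_univ j)
  rw [norm_mul, Complex.norm_real, Real.norm_of_nonneg (logDot_nonneg hb k)]
  calc logDot b k * ‖logCoeff P k‖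
      ≤ (∑ j, Real.log (b j)) * ((∑ j, k j : ℕ) : ℝ) * ‖logCoeff P k‖ :=
        mul_le_mul_of_nonneg_right h1 (norm_nonneg _)
    _ = (∑ j, Real.log (b j)) * (((∑ j, k j : ℕ) : ℝ) * ‖logCoeff P k‖) := mul_assoc _ _ _
    _ ≤ _ := mul_le_mul_of_nonneg_left (hP.norm_logCoeff_le k) hS

/-! ### The Dirichlet polynomial -/

lemma cpow_neg_eq_exp {x : ℝ} (hx : 1 < x) (s : ℂ) :
    (x : ℂ) ^ (-s) = Complex.exp (-(Real.log x * s)) := by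
  rw [Complex.cpow_def_of_ne_zero (by exact_mod_cast (zero_lt_one.trans hx).ne'),
    ← Complex.ofReal_log (zero_lt_one.trans hx).le, mul_neg]

lemma prod_cpow_eq_exp {n : ℕ} {b : Fin n → ℝ} (hb : ∀ j, 1 < b j) (k : Fin n → ℕ) (s : ℂ) :
    ∏ j, ((b j : ℂ) ^ (-s)) ^ k j = Complex.exp (-(logDot b k * s)) := by
  simp only [cpow_neg_eq_exp (hb _), ← Complex.exp_nat_mul]
  rw [← Complex.exp_sum, ofReal_logDot, Finset.sum_mul, ← Finset.sum_neg_distrib]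
  congr 1
  exact Finset.sum_congr rfl fun j _ => by ring

lemma dirichletPoly_eq_sum {n : ℕ} (P : MvPolynomial (Fin n) ℂ) {b : Fin n → ℝ}
    (hb : ∀ j, 1 < b j) (s : ℂ) :
    dirichletPoly P b s =
      ∑ k ∈ P.support, P.coeff k * Complex.exp (-(logDot b k * s)) := by
  rw [dirichletPoly, MvPolynomial.eval_eq']
  exact Finset.sum_congr rfl fun k _ => by rw [prod_cpow_eq_exp hb]

lemma hasDerivAt_exp_neg_mul (c s : ℂ) :
    HasDerivAt (fun s : ℂ => Complex.exp (-(c * s))) (Complex.exp (-(c * s)) * -c) s := by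
  have h := ((hasDerivAt_id s).const_mul c).fun_neg.cexp
  simpa using h

lemma hasDerivAt_dirichletPoly {n : ℕ} (P : MvPolynomial (Fin n) ℂ) {b : Fin n → ℝ}
    (hb : ∀ j, 1 < b j) (s : ℂ) :
    HasDerivAt (dirichletPoly P b)
      (∑ k ∈ P.support, P.coeff k * (Complex.exp (-(logDot b k * s)) * -logDot b k)) s := by
  rw [show dirichletPoly P b = fun s => ∑ k ∈ P.support, P.coeff k *
    Complex.exp (-(logDot b k * s)) from funext (dirichletPoly_eq_sum P hb)]
  refine HasDerivAt.fun_sum fun k _ => ?_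
  exact (hasDerivAt_exp_neg_mul _ s).const_mul _

lemma differentiable_dirichletPoly {n : ℕ} (P : MvPolynomial (Fin n) ℂ) {b : Fin n → ℝ}
    (hb : ∀ j, 1 < b j) : Differentiable ℂ (dirichletPoly P b) :=
  fun s => (hasDerivAt_dirichletPoly P hb s).differentiableAt

lemma IsDStable.dirichletPoly_ne_zero {n : ℕ} {P : MvPolynomial (Fin n) ℂ} (hP : IsDStable P)
    {b : Fin n → ℝ} (hb : ∀ j, 1 < b j) {s : ℂ} (hs : 0 < s.re) : dirichletPoly P b s ≠ 0 := by
  refine hP _ fun j => ?_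
  rw [cpow_neg_eq_exp (hb j), Complex.norm_exp, Real.exp_lt_one_iff]
  simpa using mul_pos (Real.log_pos (hb j)) hs

lemma norm_exp_neg_logDot {n : ℕ} (b : Fin n → ℝ) (k : Fin n → ℕ) (s : ℂ) :
    ‖Complex.exp (-(logDot b k * s))‖ = Real.exp (-(logDot b k * s.re)) := by
  rw [Complex.norm_exp]
  simp

lemma summable_exp_neg_logDot {n : ℕ} {b : Fin n → ℝ} (hb : ∀ j, 1 < b j) {σ : ℝ} (hσ : 0 < σ) :
    Summable fun k : Fin n →₀ ℕ => Real.exp (-(logDot b k * σ)) := by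
  -- The constant comes from `x^{2n}/(2n)! ≤ e^x` at `x = (1 + ξ·k)σ`; the shift by 1 produces the
  -- factor `e^σ`.
  refine Summable.of_nonneg_of_le (fun _ => (Real.exp_pos _).le) (fun k => ?_)
    ((summable_one_add_logDot hb).mul_left ((2 * n).factorial * Real.exp σ * (σ ^ (2 * n))⁻¹))
  have hk : 0 < 1 + logDot b k := by linarith [logDot_nonneg hb k]
  have h := Real.pow_div_factorial_le_exp ((1 + logDot b k) * σ) (by positivity) (2 * n)
  rw [div_le_iff₀ (by positivity), mul_pow, add_mul, one_mul, Real.exp_add] at h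
  have h2 : 0 < (1 + logDot b k) ^ (2 * n) := by positivity
  have h3 : 0 < σ ^ (2 * n) := by positivity
  rw [Real.exp_neg, ← div_eq_mul_inv, ← div_eq_mul_inv, div_div, inv_eq_one_div,
    div_le_div_iff₀ (Real.exp_pos _) (by positivity)]
  linarith

lemma summable_bounded_mul_exp {n : ℕ} {b : Fin n → ℝ} (hb : ∀ j, 1 < b j) {s : ℂ}
    (hs : 0 < s.re) {g : (Fin n →₀ ℕ) → ℂ} {C : ℝ} (hg : ∀ k, ‖g k‖ ≤ C) :
    Summable fun k : Fin n →₀ ℕ => ‖g k * Complex.exp (-(logDot b k * s))‖ := by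
  refine Summable.of_nonneg_of_le (fun _ => norm_nonneg _) (fun k => ?_)
    ((summable_exp_neg_logDot hb hs).mul_left C)
  rw [norm_mul, norm_exp_neg_logDot]
  exact mul_le_mul_of_nonneg_right (hg k) (Real.exp_pos _).le

/-- The Dirichlet series of the logarithmic derivative `F' / F` in the right half-plane. -/
lemma IsDStable.hasSum_logDeriv {n : ℕ} {P : MvPolynomial (Fin n) ℂ} (hP : IsDStable P)
    {b : Fin n → ℝ} (hb : ∀ j, 1 < b j) {s : ℂ} (hs : 0 < s.re) :
    HasSum (fun k : Fin n →₀ ℕ =>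
        (logDot b k : ℂ) * logCoeff P k * Complex.exp (-(logDot b k * s)))
      (-logDeriv (dirichletPoly P b) s) := by
  obtain ⟨C, -, hC⟩ := exists_norm_logDot_mul_logCoeff_le hP hb
  have hg := summable_bounded_mul_exp hb hs hC
  set f : (Fin n →₀ ℕ) → ℂ := fun k => P.coeff k * Complex.exp (-(logDot b k * s)) with hf
  set g : (Fin n →₀ ℕ) → ℂ := fun k =>
    (logDot b k : ℂ) * logCoeff P k * Complex.exp (-(logDot b k * s)) with hgd
  have hf0 : ∀ k ∉ P.support, f k = 0 := fun k hk => by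
    rw [hf]; simp [MvPolynomial.notMem_support_iff.mp hk]
  have hfs : Summable fun k => ‖f k‖ := summable_of_ne_finset_zero (s := P.support) fun k hk => by
    rw [hf0 k hk, norm_zero]
  have hfsum : ∑' k, f k = dirichletPoly P b s := by
    rw [tsum_eq_sum hf0, dirichletPoly_eq_sum P hb]
  have hfg := summable_mul_of_summable_norm hfs hg
  -- Cauchy product of the finite sum `F` with the candidate series: exponentials multiply because
  -- `ξ·k` is additive, and `sum_antidiagonal_logCoeff` identifies the result with `-F'`.
  have hprod := hfs.of_norm.tsum_mul_tsum_eq_tsum_sum_antidiagonal hg.of_norm hfg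
  have hanti : ∀ k, ∑ p ∈ Finset.HasAntidiagonal.antidiagonal k, f p.1 * g p.2 =
      (logDot b k : ℂ) * P.coeff k * Complex.exp (-(logDot b k * s)) := by
    intro k
    have h := sum_antidiagonal_logCoeff (fun j => (Real.log (b j) : ℂ)) hP.coeff_zero_ne k
    simp only [← ofReal_logDot] at h
    rw [← h, Finset.sum_mul]
    refine Finset.sum_congr rfl fun p hp => ?_
    rw [← Finset.HasAntidiagonal.mem_antidiagonal.mp hp, Finsupp.coe_add, logDot_add, hf, hgd]
    push_cast
    rw [add_mul, neg_add, Complex.exp_add]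
    ring
  have hder : deriv (dirichletPoly P b) s =
      -∑' k : Fin n →₀ ℕ, (logDot b k : ℂ) * P.coeff k * Complex.exp (-(logDot b k * s)) := by
    rw [(hasDerivAt_dirichletPoly P hb s).deriv, tsum_eq_sum (s := P.support) fun k hk => by
      simp [MvPolynomial.notMem_support_iff.mp hk], ← Finset.sum_neg_distrib]
    exact Finset.sum_congr rfl fun k _ => by ring
  rw [tsum_congr hanti] at hprod
  rw [hfsum] at hprod
  have h : -logDeriv (dirichletPoly P b) s = ∑' k, g k := by
    rw [logDeriv_apply, hder, ← hprod]
    have := hP.dirichletPoly_ne_zero hb hs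
    field_simp
    rfl
  rw [h]
  exact hg.of_norm.hasSum

/-! ### The functional equation -/

lemma IsStablePair.dirichletPoly_right {n : ℕ} {P Q : MvPolynomial (Fin n) ℂ} {ℓ : Fin n → ℕ}
    {η : ℂ} (hPQ : IsStablePair P Q ℓ η) {b : Fin n → ℝ} (hb : ∀ j, 1 < b j) (s : ℂ) :
    dirichletPoly Q b s = η * Complex.exp (-(logDot b ℓ * s)) * dirichletPoly P b (-s) := by
  rw [dirichletPoly, hPQ.functional_equation _ fun j => ?_, prod_cpow_eq_exp hb, dirichletPoly]
  · simp only [Complex.cpow_neg, neg_neg, inv_inv]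
  · rw [cpow_neg_eq_exp (hb j)]
    exact Complex.exp_ne_zero _

/-- In the left half-plane, `F(s)` is a factor of `F_Q(-s)`, which is nonzero by stability of `Q`.
-/
lemma IsStablePair.dirichletPoly_left_ne_zero {n : ℕ} {P Q : MvPolynomial (Fin n) ℂ}
    {ℓ : Fin n → ℕ} {η : ℂ} (hPQ : IsStablePair P Q ℓ η) {b : Fin n → ℝ} (hb : ∀ j, 1 < b j)
    {s : ℂ} (hs : s.re ≠ 0) : dirichletPoly P b s ≠ 0 := by
  rcases lt_or_gt_of_ne hs with h | h
  · have h1 := hPQ.stable_right.dirichletPoly_ne_zero hb (s := -s) (by simpa using h)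
    rw [hPQ.dirichletPoly_right hb, neg_neg] at h1
    exact right_ne_zero_of_mul h1
  · exact hPQ.stable_left.dirichletPoly_ne_zero hb h

lemma IsStablePair.logDeriv_neg {n : ℕ} {P Q : MvPolynomial (Fin n) ℂ}
    {ℓ : Fin n → ℕ} {η : ℂ} (hPQ : IsStablePair P Q ℓ η) {b : Fin n → ℝ} (hb : ∀ j, 1 < b j)
    {s : ℂ} (hs : 0 < s.re) :
    logDeriv (dirichletPoly P b) (-s) =
      -logDot b ℓ - logDeriv (dirichletPoly Q b) s := by
  have hQ := hPQ.stable_right.dirichletPoly_ne_zero hb hs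
  rw [hPQ.dirichletPoly_right hb] at hQ
  have hP : dirichletPoly P b (-s) ≠ 0 := right_ne_zero_of_mul hQ
  have hη : η ≠ 0 := left_ne_zero_of_mul (left_ne_zero_of_mul hQ)
  have h1 : HasDerivAt (fun s => dirichletPoly P b (-s))
      (-deriv (dirichletPoly P b) (-s)) s := by
    have := (differentiable_dirichletPoly P hb (-s)).hasDerivAt.comp s (hasDerivAt_neg s)
    simpa [Function.comp_def] using this
  have h2 : HasDerivAt (fun s : ℂ => η * Complex.exp (-(logDot b ℓ * s)))
      (η * (Complex.exp (-(logDot b ℓ * s)) * -logDot b ℓ)) s :=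
    (hasDerivAt_exp_neg_mul _ s).const_mul _
  have h3 := (h2.mul h1).deriv
  have h4 : dirichletPoly Q b = (fun s : ℂ => η * Complex.exp (-(logDot b ℓ * s))) *
      fun s => dirichletPoly P b (-s) := funext (hPQ.dirichletPoly_right hb)
  rw [← h4] at h3
  rw [logDeriv_apply, logDeriv_apply, h3, hPQ.dirichletPoly_right hb]
  have := Complex.exp_ne_zero (-(logDot b ℓ * s))
  field_simp
  ring

end StableCrystalline

namespace StableCrystalline

open Filter Topology

/-! ### Tempered distributions that are sums of point masses -/

lemma norm_schwartz_le (N : ℕ) (h : 𝓢(ℝ, ℂ)) (x : ℝ) :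
    ‖h x‖ ≤ 2 ^ N * (Finset.Iic (N, 0)).sup (schwartzSeminormFamily ℂ ℝ ℂ) h *
      ((1 + |x|) ^ N)⁻¹ := by
  have h1 := SchwartzMap.one_add_le_sup_seminorm_apply (𝕜 := ℂ) (m := (N, 0)) (k := N) (n := 0)
    le_rfl le_rfl h x
  rw [norm_iteratedFDeriv_zero, Real.norm_eq_abs] at h1
  have h2 : 0 < (1 + |x|) ^ N := by positivity
  rw [← div_eq_mul_inv, le_div_iff₀ h2, mul_comm]
  exact h1

lemma summable_mul_schwartz {ι : Type*} {a : ι → ℂ} {x : ι → ℝ} {N : ℕ}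
    (hs : Summable fun i => ‖a i‖ * ((1 + |x i|) ^ N)⁻¹) (h : 𝓢(ℝ, ℂ)) :
    Summable fun i => ‖a i * h (x i)‖ := by
  refine Summable.of_nonneg_of_le (fun _ => norm_nonneg _) (fun i => ?_)
    (hs.mul_left (2 ^ N * (Finset.Iic (N, 0)).sup (schwartzSeminormFamily ℂ ℝ ℂ) h))
  rw [norm_mul, mul_left_comm]
  exact mul_le_mul_of_nonneg_left (norm_schwartz_le N h _) (norm_nonneg _)

/-- Polynomially weighted summability bounds the sum by finitely many Schwartz seminorms, which is
continuity. -/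
lemma exists_temperedDistribution_hasSum {ι : Type*} {a : ι → ℂ} {x : ι → ℝ} {N : ℕ}
    (hs : Summable fun i => ‖a i‖ * ((1 + |x i|) ^ N)⁻¹) :
    ∃ T : 𝓢'(ℝ, ℂ), ∀ h : 𝓢(ℝ, ℂ), HasSum (fun i => a i * h (x i)) (T h) := by
  have hsum : ∀ h : 𝓢(ℝ, ℂ), Summable fun i => a i * h (x i) :=
    fun h => (summable_mul_schwartz hs h).of_norm
  refine ⟨ContinuousLinearMap.toPointwiseConvergenceCLM _ _ _ _
    (SchwartzMap.mkCLMtoNormedSpace (𝕜 := ℂ) (σ := RingHom.id ℂ)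
      (fun h : 𝓢(ℝ, ℂ) => ∑' i, a i * h (x i)) (fun f g => ?_) (fun c f => ?_)
      ⟨Finset.Iic (N, 0), 2 ^ N * ∑' i, ‖a i‖ * ((1 + |x i|) ^ N)⁻¹, ?_, fun h => ?_⟩),
    fun h => (hsum h).hasSum⟩
  · simp only [add_apply, mul_add]
    exact (hsum f).tsum_add (hsum g)
  · simp only [smul_apply, smul_eq_mul, mul_left_comm _ c, RingHom.id_apply]
    exact tsum_mul_left
  · have : 0 ≤ ∑' i, ‖a i‖ * ((1 + |x i|) ^ N)⁻¹ := tsum_nonneg fun i => by positivity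
    positivity
  · refine (norm_tsum_le_tsum_norm (summable_mul_schwartz hs h)).trans ?_
    rw [mul_right_comm, ← tsum_mul_left]
    refine (summable_mul_schwartz hs h).tsum_le_tsum (fun i => ?_) (hs.mul_left _)
    rw [norm_mul, mul_left_comm]
    exact mul_le_mul_of_nonneg_left (norm_schwartz_le N h _) (norm_nonneg _)

lemma isDiscreteSum_of_hasSum {T : 𝓢'(ℝ, ℂ)} {c : ℝ → ℂ}
    (hc : ∀ R : ℝ, (Function.support c ∩ Set.Icc (-R) R).Finite)
    (hT : ∀ h : 𝓢(ℝ, ℂ), HasSum (fun t => c t * h t) (T h)) : IsDiscreteSum T c := by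
  refine ⟨hc, fun φ hφ => ?_⟩
  rw [← (hT φ).tsum_eq]
  refine tsum_eq_finsum ?_
  obtain ⟨R, hR⟩ := hφ.isBounded.subset_closedBall 0
  refine (hc R).subset fun t ht => ?_
  have ht' : c t ≠ 0 ∧ φ t ≠ 0 := by simpa using ht
  refine ⟨ht'.1, ?_⟩
  have := hR (subset_tsupport _ ht'.2)
  rwa [Real.closedBall_eq_Icc, zero_sub, zero_add] at this

/-- The total mass at `t` of the point masses `a i` at `x i`. -/
noncomputable def massAt {ι : Type*} (a : ι → ℂ) (x : ι → ℝ) (t : ℝ) : ℂ :=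
  ∑' i : x ⁻¹' {t}, a i

lemma exists_of_massAt_ne_zero {ι : Type*} {a : ι → ℂ} {x : ι → ℝ} {t : ℝ}
    (h : massAt a x t ≠ 0) : ∃ i, x i = t := by
  by_contra! hx
  have : IsEmpty (x ⁻¹' {t}) := ⟨fun i => hx i i.2⟩
  exact h tsum_empty

lemma finite_support_massAt {ι : Type*} (a : ι → ℂ) {x : ι → ℝ}
    (hx : ∀ R : ℝ, {i | |x i| ≤ R}.Finite) (R : ℝ) :
    (Function.support (massAt a x) ∩ Set.Icc (-R) R).Finite := by
  refine ((hx R).image x).subset ?_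
  rintro t ⟨ht, htR⟩
  obtain ⟨i, rfl⟩ := exists_of_massAt_ne_zero ht
  exact ⟨i, abs_le.mpr htR, rfl⟩

/-- Distinct indices may share a position, for instance when the `log b_j` are rationally dependent,
so masses are collected along the fibres of `x`. -/
lemma hasSum_massAt_mul {ι : Type*} {a : ι → ℂ} {x : ι → ℝ} {h : ℝ → ℂ} {A : ℂ}
    (hA : HasSum (fun i => a i * h (x i)) A) : HasSum (fun t => massAt a x t * h t) A := by
  have h1 : (fun t => massAt a x t * h t) =
      fun t => ∑' i : x ⁻¹' {t}, a i * h (x i) := funext fun t => by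
    rw [massAt, ← tsum_mul_right]
    exact tsum_congr fun i => by rw [show x i = t from i.2]
  rw [h1]
  exact hA.tsum_fiberwise x

lemma isDiscreteSum_massAt {ι : Type*} {a : ι → ℂ} {x : ι → ℝ}
    (hx : ∀ R : ℝ, {i | |x i| ≤ R}.Finite) {T : 𝓢'(ℝ, ℂ)}
    (hT : ∀ h : 𝓢(ℝ, ℂ), HasSum (fun i => a i * h (x i)) (T h)) :
    IsDiscreteSum T (massAt a x) :=
  isDiscreteSum_of_hasSum (finite_support_massAt a hx) fun h => hasSum_massAt_mul (hT h)

lemma exists_isDiscreteSum_norm {c : ℝ → ℂ} {N : ℕ}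
    (hc : ∀ R : ℝ, (Function.support c ∩ Set.Icc (-R) R).Finite)
    (hs : Summable fun t => ‖c t‖ * ((1 + |t|) ^ N)⁻¹) :
    ∃ T : 𝓢'(ℝ, ℂ), IsDiscreteSum T fun t => ((‖c t‖ : ℝ) : ℂ) := by
  obtain ⟨T, hT⟩ := exists_temperedDistribution_hasSum (a := fun t => ((‖c t‖ : ℝ) : ℂ))
    (x := fun t => t) (N := N) (by simpa using hs)
  refine ⟨T, isDiscreteSum_of_hasSum (fun R => ?_) hT⟩
  convert hc R using 2
  ext t
  simp

/-- Triangle inequality in each finite fibre. Cancellation between coinciding masses only helps, so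
the variation of the collected measure remains tempered. -/
lemma summable_norm_massAt {ι : Type*} {a : ι → ℂ} {x : ι → ℝ} {N : ℕ}
    (hx : ∀ R : ℝ, {i | |x i| ≤ R}.Finite)
    (hs : Summable fun i => ‖a i‖ * ((1 + |x i|) ^ N)⁻¹) :
    Summable fun t => ‖massAt a x t‖ * ((1 + |t|) ^ N)⁻¹ := by
  refine Summable.of_nonneg_of_le (fun t => by positivity) (fun t => ?_)
    (hs.hasSum.tsum_fiberwise x).summable
  have hfin : Finite (x ⁻¹' {t}) := ((hx |t|).subset fun i hi => by
    rw [Set.mem_preimage, Set.mem_singleton_iff] at hi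
    simp [hi]).to_subtype
  have h1 : ‖massAt a x t‖ ≤ ∑' i : x ⁻¹' {t}, ‖a i‖ :=
    norm_tsum_le_tsum_norm Summable.of_finite
  calc _ ≤ (∑' i : x ⁻¹' {t}, ‖a i‖) * ((1 + |t|) ^ N)⁻¹ :=
        mul_le_mul_of_nonneg_right h1 (by positivity)
    _ = ∑' i : x ⁻¹' {t}, ‖a i‖ * ((1 + |x i|) ^ N)⁻¹ := by
        rw [← tsum_mul_right]
        exact tsum_congr fun i => by rw [show x i = t from i.2]

/-! ### Density of the compactly supported Schwartz functions -/

lemma bounded_iteratedDeriv_of_hasCompactSupport {f : ℝ → ℂ} (hf : ContDiff ℝ (⊤ : ℕ∞) f)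
    (hc : HasCompactSupport f) (i : ℕ) : ∃ B : ℝ, ∀ x, ‖iteratedDeriv i f x‖ ≤ B := by
  have h : Continuous (iteratedFDeriv ℝ i f) :=
    hf.continuous_iteratedFDeriv (by exact_mod_cast le_top)
  obtain ⟨B, hB⟩ := (hc.iteratedFDeriv (𝕜 := ℝ) i).exists_bound_of_continuous h
  exact ⟨B, fun x => by rw [← norm_iteratedFDeriv_eq_norm_iteratedDeriv]; exact hB x⟩

/-- Cut `φ` off by `χ(x/(m+1))`. The error vanishes for `|x| < m + 1`; beyond, one spare power of
`|x|`, taken from the seminorms of index `k + 1`, yields a factor `1/(m+1)`. -/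
theorem dense_hasCompactSupport_schwartz :
    Dense {φ : 𝓢(ℝ, ℂ) | HasCompactSupport φ} := by
  intro φ
  let χ : ContDiffBump (0 : ℝ) := ⟨1, 2, one_pos, one_lt_two⟩
  set χc : ℝ → ℂ := fun x => (χ x : ℂ) with hχc
  have hχ : ContDiff ℝ (⊤ : ℕ∞) χc := Complex.ofRealCLM.contDiff.comp χ.contDiff
  have hχs : HasCompactSupport χc := χ.hasCompactSupport.comp_left Complex.ofReal_zero
  have hscale : ∀ m : ℕ, ContDiff ℝ (⊤ : ℕ∞) fun x : ℝ => χc (((m : ℝ) + 1)⁻¹ * x) :=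
    fun m => hχ.comp (contDiff_const.mul contDiff_id)
  have hsmooth : ∀ m : ℕ, ContDiff ℝ (⊤ : ℕ∞) fun x : ℝ => χc (((m : ℝ) + 1)⁻¹ * x) * φ x :=
    fun m => (hscale m).mul (φ.smooth _)
  have hcs : ∀ m : ℕ, HasCompactSupport fun x : ℝ => χc (((m : ℝ) + 1)⁻¹ * x) * φ x := fun m =>
    (hχs.comp_homeomorph (Homeomorph.mulLeft₀ _ (by positivity))).mul_right
  set u : ℕ → 𝓢(ℝ, ℂ) := fun m => (hcs m).toSchwartzMap (hsmooth m) with hu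
  refine mem_closure_of_tendsto (f := u) (b := atTop) ?_ (Eventually.of_forall fun m => hcs m)
  rw [(schwartz_withSeminorms ℂ ℝ ℂ).tendsto_nhds]
  rintro ⟨k, N⟩ ε hε
  set g : ℝ → ℂ := fun x => χc x - 1 with hg
  have hgs : ContDiff ℝ (⊤ : ℕ∞) g := hχ.sub contDiff_const
  have hB : ∀ i, ∃ B : ℝ, ∀ x, ‖iteratedDeriv i g x‖ ≤ B := by
    intro i
    obtain ⟨B, hB⟩ := bounded_iteratedDeriv_of_hasCompactSupport hχ hχs i
    refine ⟨B + 1, fun x => ?_⟩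
    have h1 : iteratedDeriv i g x = iteratedDeriv i χc x - iteratedDeriv i (fun _ => (1 : ℂ)) x :=
      iteratedDeriv_sub (hχ.contDiffAt.of_le (by exact_mod_cast le_top)) contDiffAt_const
    rw [h1]
    refine (norm_sub_le _ _).trans (add_le_add (hB x) ?_)
    rw [iteratedDeriv_const]
    split_ifs <;> simp
  choose B hB using hB
  set K : ℝ := ∑ i ∈ Finset.range (N + 1), (N.choose i : ℝ) * B i *
    SchwartzMap.seminorm ℂ (k + 1) (N - i) φ with hK
  have hB0 : ∀ i, 0 ≤ B i := fun i => (norm_nonneg _).trans (hB i 0)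
  have hK0 : 0 ≤ K := Finset.sum_nonneg fun i _ =>
    mul_nonneg (mul_nonneg (Nat.cast_nonneg _) (hB0 i)) (apply_nonneg _ _)
  have key : ∀ m : ℕ, SchwartzMap.seminorm ℂ k N (u m - φ) ≤ ((m : ℝ) + 1)⁻¹ * K := by
    intro m
    refine SchwartzMap.seminorm_le_bound ℂ k N _ (by positivity) fun x => ?_
    have hfun : ⇑(u m - φ) = fun x : ℝ => g (((m : ℝ) + 1)⁻¹ * x) * φ x := by
      ext y
      change χc (((m : ℝ) + 1)⁻¹ * y) * φ y - φ y = _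
      simp only [hg]
      ring
    rw [hfun]
    have hm : (0 : ℝ) < (m : ℝ) + 1 := by positivity
    by_cases hx : |x| < (m : ℝ) + 1
    · have h0 : (fun x : ℝ => g (((m : ℝ) + 1)⁻¹ * x) * φ x) =ᶠ[𝓝 x] fun _ => 0 := by
        filter_upwards [(isOpen_lt continuous_abs continuous_const).mem_nhds hx] with y hy
        have hy' : ((m : ℝ) + 1)⁻¹ * y ∈ Metric.closedBall (0 : ℝ) 1 := by
          rw [mem_closedBall_zero_iff, Real.norm_eq_abs, abs_mul, abs_of_pos (inv_pos.mpr hm),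
            ← div_eq_inv_mul, div_le_one₀ hm]
          exact (show |y| < (m : ℝ) + 1 from hy).le
        have : χ (((m : ℝ) + 1)⁻¹ * y) = 1 := χ.one_of_mem_closedBall hy'
        simp [hg, hχc, this]
      rw [norm_iteratedFDeriv_eq_norm_iteratedDeriv, h0.iteratedDeriv_eq, iteratedDeriv_const]
      simp only [ite_self, norm_zero, mul_zero]
      positivity
    · have hx' : (m : ℝ) + 1 ≤ |x| := not_lt.mp hx
      have hgm : ContDiff ℝ (⊤ : ℕ∞) fun x : ℝ => g (((m : ℝ) + 1)⁻¹ * x) :=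
        hgs.comp (contDiff_const.mul contDiff_id)
      have h1 := norm_iteratedFDeriv_mul_le hgm (φ.smooth (⊤ : ℕ∞)) x (n := N)
        (by exact_mod_cast le_top)
      refine (mul_le_mul_of_nonneg_left h1 (by positivity)).trans ?_
      rw [hK, Finset.mul_sum, Finset.mul_sum]
      refine Finset.sum_le_sum fun i _ => ?_
      have h2 : ‖iteratedFDeriv ℝ i (fun x : ℝ => g (((m : ℝ) + 1)⁻¹ * x)) x‖ ≤ B i := by
        rw [norm_iteratedFDeriv_eq_norm_iteratedDeriv,
          iteratedDeriv_comp_const_smul (hgs.of_le (by exact_mod_cast le_top)), norm_smul, norm_pow]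
        have h3 : ‖((m : ℝ) + 1)⁻¹‖ ^ i ≤ 1 := by
          refine pow_le_one₀ (norm_nonneg _) ?_
          rw [norm_inv, Real.norm_of_nonneg hm.le]
          exact inv_le_one_of_one_le₀ (by linarith [Nat.cast_nonneg (α := ℝ) m])
        calc _ ≤ 1 * B i := mul_le_mul h3 (hB i _) (norm_nonneg _) zero_le_one
          _ = B i := one_mul _
      have h4 := SchwartzMap.le_seminorm ℂ (k + 1) (N - i) φ x
      have h5 : ‖x‖ ^ k * ‖iteratedFDeriv ℝ (N - i) φ x‖ ≤
          ((m : ℝ) + 1)⁻¹ * SchwartzMap.seminorm ℂ (k + 1) (N - i) φ := by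
        rw [← div_eq_inv_mul, le_div_iff₀ hm]
        refine le_trans ?_ h4
        rw [pow_succ, mul_right_comm]
        exact mul_le_mul_of_nonneg_right (mul_le_mul_of_nonneg_left hx' (by positivity))
          (norm_nonneg _)
      calc ‖x‖ ^ k * ((N.choose i : ℝ) * ‖iteratedFDeriv ℝ i
              (fun x : ℝ => g (((m : ℝ) + 1)⁻¹ * x)) x‖ * ‖iteratedFDeriv ℝ (N - i) φ x‖)
          = (N.choose i : ℝ) * ‖iteratedFDeriv ℝ i (fun x : ℝ => g (((m : ℝ) + 1)⁻¹ * x)) x‖ *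
            (‖x‖ ^ k * ‖iteratedFDeriv ℝ (N - i) φ x‖) := by ring
        _ ≤ (N.choose i : ℝ) * B i *
            (((m : ℝ) + 1)⁻¹ * SchwartzMap.seminorm ℂ (k + 1) (N - i) φ) := by
            have := hB0 i
            gcongr
        _ = _ := by ring
  have hlim : Tendsto (fun m : ℕ => ((m : ℝ) + 1)⁻¹ * K) atTop (𝓝 0) := by
    have := (tendsto_one_div_add_atTop_nhds_zero_nat (𝕜 := ℝ)).mul_const K
    simpa using this
  filter_upwards [hlim.eventually_lt_const hε] with m hm
  exact (key m).trans_lt hm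

end StableCrystalline

namespace StableCrystalline

open Filter Topology MeasureTheory

/-! ### Local factorization of an entire function -/

section Entire

variable {F : ℂ → ℂ}

lemma analyticOrderAt_ne_top_of_entire (hF : Differentiable ℂ F) {z₀ : ℂ} (h0 : F z₀ ≠ 0) (z : ℂ) :
    analyticOrderAt F z ≠ ⊤ := by
  intro h
  rw [analyticOrderAt_eq_top] at h
  have hA : AnalyticOnNhd ℂ F Set.univ := fun z _ => hF.analyticAt z
  exact h0 (hA.eqOn_zero_of_preconnected_of_eventuallyEq_zero isPreconnected_univ
    (Set.mem_univ z) h (Set.mem_univ z₀))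

lemma one_le_analyticOrderNatAt_iff (hF : Differentiable ℂ F) {z₀ : ℂ} (h0 : F z₀ ≠ 0) (z : ℂ) :
    1 ≤ analyticOrderNatAt F z ↔ F z = 0 := by
  rw [Nat.one_le_iff_ne_zero, ne_eq, analyticOrderNatAt, ENat.toNat_eq_zero,
    or_iff_left (analyticOrderAt_ne_top_of_entire hF h0 z),
    (hF.analyticAt z).analyticOrderAt_eq_zero, not_not]

lemma divisor_eq_analyticOrderNatAt (hF : Differentiable ℂ F) {z₀ : ℂ} (h0 : F z₀ ≠ 0)
    {U : Set ℂ} {z : ℂ} (hz : z ∈ U) :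
    MeromorphicOn.divisor F U z = (analyticOrderNatAt F z : ℤ) := by
  have hA : AnalyticOnNhd ℂ F U := fun z _ => hF.analyticAt z
  rw [MeromorphicOn.AnalyticOnNhd.divisor_apply hA hz, analyticOrderNatAt]
  have := analyticOrderAt_ne_top_of_entire hF h0 z
  generalize analyticOrderAt F z = o at this
  cases o with
  | top => exact absurd rfl this
  | coe m => rfl

/-- Dividing `F` by its finitely many zeros in the closed disk leaves a zero-free analytic `g`; the
logarithmic derivative turns the product into a sum. -/
lemma exists_logDeriv_eq_sum_add (hF : Differentiable ℂ F) {z₀ : ℂ} (h0 : F z₀ ≠ 0) (R : ℝ) :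
    ∃ (Z : Finset ℂ) (g : ℂ → ℂ), (∀ z, z ∈ Z ↔ z ∈ Metric.closedBall 0 R ∧ F z = 0) ∧
      AnalyticOnNhd ℂ g (Metric.closedBall 0 R) ∧ (∀ z ∈ Metric.closedBall 0 R, g z ≠ 0) ∧
      ∀ z ∈ Metric.ball 0 R, F z ≠ 0 → logDeriv F z =
        ∑ u ∈ Z, (analyticOrderNatAt F u : ℂ) / (z - u) + logDeriv g z := by
  set K : Set ℂ := Metric.closedBall 0 R with hK
  have hA : AnalyticOnNhd ℂ F K := fun z _ => hF.analyticAt z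
  have hD : (MeromorphicOn.divisor F K).support.Finite :=
    (MeromorphicOn.divisor F K).finiteSupport (isCompact_closedBall 0 R)
  have htop : ∀ u : K, meromorphicOrderAt F u ≠ ⊤ := fun u => by
    rw [(hA u u.2).meromorphicOrderAt_eq, ne_eq, ENat.map_eq_top_iff]
    exact analyticOrderAt_ne_top_of_entire hF h0 u
  obtain ⟨g, hg, hg0, hFg⟩ := hA.meromorphicOn.extract_zeros_poles htop hD
  have hmem : ∀ z, z ∈ hD.toFinset ↔ z ∈ K ∧ F z = 0 := by
    intro z
    rw [Set.Finite.mem_toFinset, Function.mem_support]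
    by_cases hz : z ∈ K
    · rw [divisor_eq_analyticOrderNatAt hF h0 hz, ← one_le_analyticOrderNatAt_iff hF h0 z]
      simp [hz, Nat.one_le_iff_ne_zero]
    · simp [hz]
  refine ⟨hD.toFinset, g, hmem, hg, fun z hz => hg0 ⟨z, hz⟩, fun z hz hFz => ?_⟩
  have hzK : z ∈ K := Metric.ball_subset_closedBall hz
  have hprod : (∏ᶠ u, (· - u) ^ MeromorphicOn.divisor F K u : ℂ → ℂ) =
      ∏ u ∈ hD.toFinset, fun z : ℂ => (z - u) ^ analyticOrderNatAt F u := by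
    rw [finprod_eq_prod_of_mulSupport_subset (s := hD.toFinset)]
    · refine Finset.prod_congr rfl fun u hu => ?_
      ext w
      rw [divisor_eq_analyticOrderNatAt hF h0 ((hmem u).mp hu).1]
      simp
    · intro u hu
      rw [Set.Finite.coe_toFinset, Function.mem_support]
      intro h
      exact hu (by simp [h])
  rw [hprod] at hFg
  have h1 : F =ᶠ[𝓝[≠] z]
      (∏ u ∈ hD.toFinset, fun z : ℂ => (z - u) ^ analyticOrderNatAt F u) * g := by
    have h2 := mem_codiscreteWithin_iff_forall_mem_nhdsNE.mp hFg z hzK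
    filter_upwards [h2, nhdsWithin_le_nhds (Metric.isOpen_ball.mem_nhds hz)] with w hw hwR
    rcases hw with hw | hw
    · exact hw
    · exact absurd (Metric.ball_subset_closedBall hwR) hw
  have hne : ∀ u ∈ hD.toFinset, (z - u) ^ analyticOrderNatAt F u ≠ 0 := fun u hu =>
    pow_ne_zero _ (sub_ne_zero.mpr fun h => hFz (h ▸ ((hmem u).mp hu).2))
  have hdiff : ∀ u ∈ hD.toFinset,
      DifferentiableAt ℂ (fun z : ℂ => (z - u) ^ analyticOrderNatAt F u) z :=
    fun u _ => by fun_prop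
  have hlin : ∀ u : ℂ, logDeriv (fun z : ℂ => (z - u) ^ analyticOrderNatAt F u) z =
      (analyticOrderNatAt F u : ℂ) / (z - u) := fun u => by
    rw [logDeriv_fun_pow (by fun_prop), logDeriv_apply, deriv_sub_const, deriv_id'', mul_one_div]
  have hdg : DifferentiableAt ℂ g z := (hg z hzK).differentiableAt
  -- The factorization is known only off a discrete set; continuity of both sides gives it on a full
  -- neighbourhood of `z`.
  have h2 := (ContinuousAt.eventuallyEq_nhds_iff_eventuallyEq_nhdsNE hF.continuous.continuousAt
    ((DifferentiableAt.finsetProd hdiff).mul hdg).continuousAt).mp h1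
  rw [(logDeriv_congr_nhds h2).eq_of_nhds]
  have h3 := logDeriv_mul (f := ∏ u ∈ hD.toFinset, fun z : ℂ => (z - u) ^ analyticOrderNatAt F u)
    (g := g) z (by rw [Finset.prod_apply]; exact Finset.prod_ne_zero_iff.mpr hne) (hg0 ⟨z, hzK⟩)
    (DifferentiableAt.finsetProd hdiff) (hg z hzK).differentiableAt
  rw [show (∏ u ∈ hD.toFinset, fun z : ℂ => (z - u) ^ analyticOrderNatAt F u) * g = fun z =>
    (∏ u ∈ hD.toFinset, fun z : ℂ => (z - u) ^ analyticOrderNatAt F u) z * g z from rfl, h3,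
    Finset.prod_fn, logDeriv_prod hne hdiff]
  simp only [hlin]

end Entire

/-! ### The Poisson kernel of the half-plane -/

/-- Substituting `t = γ + σu` makes the kernel `2/(1 + u^2)`, independent of `σ` and of mass `2π`;
dominated convergence does the rest. -/
lemma tendsto_integral_mul_poisson {φ : ℝ → ℂ} (hφ : Continuous φ) {C : ℝ} (hC : ∀ t, ‖φ t‖ ≤ C)
    (γ : ℝ) :
    Tendsto (fun σ : ℝ => ∫ t, φ t * ((2 * σ / (σ ^ 2 + (t - γ) ^ 2) : ℝ) : ℂ)) (𝓝[>] 0)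
      (𝓝 (2 * Real.pi * φ γ)) := by
  have hsub : ∀ σ : ℝ, 0 < σ → ∫ t, φ t * ((2 * σ / (σ ^ 2 + (t - γ) ^ 2) : ℝ) : ℂ) =
      ∫ u, φ (γ + σ * u) * ((2 * (1 + u ^ 2)⁻¹ : ℝ) : ℂ) := by
    intro σ hσ
    have h1 := Measure.integral_comp_mul_left
      (fun t => φ (γ + t) * ((2 * σ / (σ ^ 2 + (γ + t - γ) ^ 2) : ℝ) : ℂ)) σ
    rw [integral_add_left_eq_self
      (fun t => φ t * ((2 * σ / (σ ^ 2 + (t - γ) ^ 2) : ℝ) : ℂ)) γ] at h1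
    rw [abs_of_pos (inv_pos.mpr hσ), eq_inv_smul_iff₀ hσ.ne', ← integral_smul] at h1
    rw [← h1]
    refine integral_congr_ae (Eventually.of_forall fun u => ?_)
    have h2 : σ ^ 2 + (γ + σ * u - γ) ^ 2 = σ ^ 2 * (1 + u ^ 2) := by ring
    have h3 : (1 + u ^ 2) ≠ 0 := by positivity
    have h4 : 2 * σ / (σ ^ 2 + (γ + σ * u - γ) ^ 2) = σ⁻¹ * (2 * (1 + u ^ 2)⁻¹) := by
      rw [h2]
      field_simp
    simp only [h4, Complex.real_smul]
    push_cast
    have h5 : (σ : ℂ) ≠ 0 := by exact_mod_cast hσ.ne'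
    field_simp
  have hlim : ∫ u : ℝ, φ γ * ((2 * (1 + u ^ 2)⁻¹ : ℝ) : ℂ) = 2 * Real.pi * φ γ := by
    rw [integral_const_mul, integral_complex_ofReal, integral_const_mul,
      integral_univ_inv_one_add_sq]
    push_cast
    ring
  rw [← hlim]
  refine Tendsto.congr' (f₁ := fun σ => ∫ u, φ (γ + σ * u) * ((2 * (1 + u ^ 2)⁻¹ : ℝ) : ℂ)) ?_ ?_
  · filter_upwards [self_mem_nhdsWithin] with σ hσ
    exact (hsub σ hσ).symm
  refine tendsto_integral_filter_of_dominated_convergence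
    (fun u => C * (2 * (1 + u ^ 2)⁻¹)) (Eventually.of_forall fun σ => ?_)
    (Eventually.of_forall fun σ => Eventually.of_forall fun u => ?_)
    ((integrable_inv_one_add_sq.const_mul 2).const_mul C)
    (Eventually.of_forall fun u => ?_)
  · have h : Continuous fun u : ℝ => (2 * (1 + u ^ 2)⁻¹ : ℝ) :=
      continuous_const.mul (Continuous.inv₀ (by fun_prop) fun u => by positivity)
    exact ((hφ.comp (by fun_prop)).mul (Complex.continuous_ofReal.comp h)).aestronglyMeasurable
  · rw [norm_mul, Complex.norm_real, Real.norm_of_nonneg (by positivity)]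
    exact mul_le_mul_of_nonneg_right (hC _) (by positivity)
  · refine Tendsto.mul_const _ ((hφ.tendsto γ).comp ?_)
    have : Tendsto (fun σ : ℝ => γ + σ * u) (𝓝 0) (𝓝 (γ + 0 * u)) :=
      (Continuous.tendsto (by fun_prop) 0)
    simpa using this.mono_left nhdsWithin_le_nhds

/-! ### The jump of the logarithmic derivative across the imaginary axis -/

/-- The difference of the logarithmic derivatives of `F` at `σ + it` and at `-σ + it`. -/
noncomputable def logDerivJump (F : ℂ → ℂ) (σ t : ℝ) : ℂ :=
  logDeriv F (σ + Complex.I * t) - logDeriv F (-σ + Complex.I * t)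

/-- With `a = t - γ`, the common denominator satisfies `-(σ + ia)(-σ + ia) = σ^2 + a^2`: a pole on
the axis jumps by a Poisson kernel. -/
lemma inv_sub_inv_eq_poisson {σ : ℝ} (hσ : 0 < σ) (t γ : ℝ) (m : ℂ) :
    m / ((σ + Complex.I * t) - Complex.I * γ) - m / ((-σ + Complex.I * t) - Complex.I * γ) =
      m * ((2 * σ / (σ ^ 2 + (t - γ) ^ 2) : ℝ) : ℂ) := by
  have h1 : (σ + Complex.I * t) - Complex.I * γ ≠ 0 := fun h => by
    have := congrArg Complex.re h
    simp at this
    exact hσ.ne' this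
  have h2 : (-σ + Complex.I * t) - Complex.I * γ ≠ 0 := fun h => by
    have := congrArg Complex.re h
    simp at this
    exact hσ.ne' this
  have h3 : ((σ ^ 2 + (t - γ) ^ 2 : ℝ) : ℂ) =
      -(((σ + Complex.I * t) - Complex.I * γ) * ((-σ + Complex.I * t) - Complex.I * γ)) := by
    push_cast
    linear_combination ((t : ℂ) - γ) ^ 2 * Complex.I_sq
  rw [Complex.ofReal_div, h3, div_sub_div _ _ h1 h2, mul_div_assoc', div_neg, ← neg_div]
  congr 1
  push_cast
  ring

/-- Zeros on the axis give approximate point masses of weight `2π`; the remaining `g'/g` is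
continuous across the axis, so its jump tends to 0. -/
lemma tendsto_integral_mul_logDerivJump {F : ℂ → ℂ} (hF : Differentiable ℂ F)
    (h0 : ∀ z : ℂ, z.re ≠ 0 → F z ≠ 0) {φ : ℝ → ℂ} (hφ : Continuous φ) (hs : HasCompactSupport φ) :
    Tendsto (fun σ : ℝ => ∫ t, φ t * logDerivJump F σ t) (𝓝[>] 0)
      (𝓝 (2 * Real.pi * ∑ᶠ γ : ℝ, (analyticOrderNatAt F (Complex.I * γ) : ℂ) * φ γ)) := by
  have hF1 : F 1 ≠ 0 := h0 1 (by simp)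
  obtain ⟨C, hC⟩ := hs.exists_bound_of_continuous hφ
  obtain ⟨R, hR⟩ := hs.isBounded.subset_closedBall 0
  have hφ0 : ∀ t ∉ Set.Icc (-R) R, φ t = 0 := fun t ht => by
    rw [Real.closedBall_eq_Icc, zero_sub, zero_add] at hR
    exact image_eq_zero_of_notMem_tsupport fun h => ht (hR h)
  -- Radius `R + 1` leaves room for the points `±σ + it` with `|t| ≤ R` and `σ < 1`.
  obtain ⟨Z, g, hZ, hg, hg0, hdec⟩ := exists_logDeriv_eq_sum_add hF hF1 (R + 1)
  have hZim : ∀ u ∈ Z, u = Complex.I * (u.im : ℂ) := fun u hu => by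
    have h : u.re = 0 := by
      by_contra h
      exact h0 u h ((hZ u).mp hu).2
    apply Complex.ext <;> simp [h]
  have hcont : ContinuousOn (logDeriv g) (Metric.closedBall 0 (R + 1)) := fun z hz =>
    ((hg z hz).deriv.continuousAt.div (hg z hz).continuousAt (hg0 z hz)).continuousWithinAt
  obtain ⟨M, hM⟩ := (isCompact_closedBall (0 : ℂ) (R + 1)).exists_bound_of_continuousOn hcont
  have hball : ∀ σ t : ℝ, |σ| < 1 → t ∈ Set.Icc (-R) R →
      (σ + Complex.I * t : ℂ) ∈ Metric.ball (0 : ℂ) (R + 1) := by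
    intro σ t hσ ht
    rw [mem_ball_zero_iff]
    have h1 : ‖(σ : ℂ)‖ < 1 := by rwa [Complex.norm_real, Real.norm_eq_abs]
    have h2 : ‖Complex.I * (t : ℂ)‖ ≤ R := by
      rw [norm_mul, Complex.norm_I, one_mul, Complex.norm_real, Real.norm_eq_abs]
      exact abs_le.mpr ht
    linarith [norm_add_le (σ : ℂ) (Complex.I * t)]
  have hjump : ∀ σ : ℝ, |σ| < 1 →
      ContinuousOn (fun t => φ t * logDerivJump g σ t) (Set.Icc (-R) R) := fun σ hσ => by
    refine hφ.continuousOn.mul (ContinuousOn.sub ?_ ?_)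
    · exact hcont.comp (Continuous.continuousOn (by fun_prop)) fun t ht =>
        Metric.ball_subset_closedBall (hball σ t hσ ht)
    · exact hcont.comp (Continuous.continuousOn (by fun_prop)) fun t ht => by
        simpa using Metric.ball_subset_closedBall (hball (-σ) t (by rwa [abs_neg]) ht)
  have hsplit : ∀ σ : ℝ, 0 < σ → σ < 1 → ∫ t, φ t * logDerivJump F σ t =
      (∑ u ∈ Z, (analyticOrderNatAt F u : ℂ) *
        ∫ t, φ t * ((2 * σ / (σ ^ 2 + (t - u.im) ^ 2) : ℝ) : ℂ)) +
      ∫ t in Set.Icc (-R) R, φ t * logDerivJump g σ t := by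
    intro σ hσ hσ1
    have hrestrict : ∀ f : ℝ → ℂ, ∫ t, φ t * f t = ∫ t in Set.Icc (-R) R, φ t * f t := fun f =>
      (setIntegral_eq_integral_of_forall_compl_eq_zero fun t ht => by
        rw [hφ0 t ht, zero_mul]).symm
    have hint : ∀ u : ℂ, IntegrableOn
        (fun t => (analyticOrderNatAt F u : ℂ) *
          (φ t * ((2 * σ / (σ ^ 2 + (t - u.im) ^ 2) : ℝ) : ℂ))) (Set.Icc (-R) R) := fun u => by
      refine (Continuous.continuousOn ?_).integrableOn_compact isCompact_Icc
      have h : Continuous fun t : ℝ => 2 * σ / (σ ^ 2 + (t - u.im) ^ 2) :=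
        continuous_const.div (by fun_prop) fun t => by positivity
      exact continuous_const.mul (hφ.mul (Complex.continuous_ofReal.comp h))
    simp only [hrestrict, ← integral_const_mul]
    rw [← integral_finsetSum _ fun u _ => hint u, ← integral_add
      (integrable_finsetSum _ fun u _ => hint u)
      ((hjump σ (by rwa [abs_of_pos hσ])).integrableOn_compact isCompact_Icc)]
    refine setIntegral_congr_fun measurableSet_Icc fun t ht => ?_
    have hp := hball σ t (by rwa [abs_of_pos hσ]) ht
    have hn := hball (-σ) t (by rwa [abs_neg, abs_of_pos hσ]) ht
    rw [Complex.ofReal_neg] at hn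
    have hFp : F (σ + Complex.I * t) ≠ 0 := h0 _ (by simpa using hσ.ne')
    have hFn : F (-σ + Complex.I * t) ≠ 0 := h0 _ (by simpa using hσ.ne')
    have hkernel : ∀ u ∈ Z, (analyticOrderNatAt F u : ℂ) / (σ + Complex.I * t - u) -
        (analyticOrderNatAt F u : ℂ) / (-σ + Complex.I * t - u) =
        (analyticOrderNatAt F u : ℂ) * ((2 * σ / (σ ^ 2 + (t - u.im) ^ 2) : ℝ) : ℂ) :=
      fun u hu => by
        rw [← inv_sub_inv_eq_poisson hσ, ← hZim u hu]
    simp only [logDerivJump]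
    rw [hdec _ hp hFp, hdec _ hn hFn, add_sub_add_comm, ← Finset.sum_sub_distrib,
      Finset.sum_congr rfl hkernel, mul_add, Finset.mul_sum]
    simp only [mul_left_comm]
  have hpoisson : Tendsto (fun σ : ℝ => ∑ u ∈ Z, (analyticOrderNatAt F u : ℂ) *
        ∫ t, φ t * ((2 * σ / (σ ^ 2 + (t - u.im) ^ 2) : ℝ) : ℂ)) (𝓝[>] 0)
      (𝓝 (∑ u ∈ Z, (analyticOrderNatAt F u : ℂ) * (2 * Real.pi * φ u.im))) :=
    tendsto_finsetSum _ fun u _ => (tendsto_integral_mul_poisson hφ hC u.im).const_mul _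
  have hsmooth : Tendsto (fun σ : ℝ => ∫ t in Set.Icc (-R) R, φ t * logDerivJump g σ t) (𝓝[>] 0)
      (𝓝 0) := by
    have hsmall : ∀ᶠ σ : ℝ in 𝓝[>] 0, |σ| < 1 := by
      filter_upwards [Ioo_mem_nhdsGT one_pos] with σ hσ
      rw [abs_of_pos hσ.1]
      exact hσ.2
    rw [show (0 : ℂ) = ∫ t in Set.Icc (-R) R, (0 : ℂ) by simp]
    refine tendsto_integral_filter_of_dominated_convergence (fun _ => C * (M + M)) ?_ ?_
      continuous_const.integrableOn_Icc ?_
    · filter_upwards [hsmall] with σ hσ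
      exact (hjump σ hσ).aestronglyMeasurable measurableSet_Icc
    · filter_upwards [hsmall] with σ hσ
      refine (ae_restrict_iff' measurableSet_Icc).mpr (Eventually.of_forall fun t ht => ?_)
      rw [norm_mul]
      refine mul_le_mul (hC t) ((norm_sub_le _ _).trans (add_le_add ?_ ?_)) (norm_nonneg _)
        ((norm_nonneg _).trans (hC t))
      · exact hM _ (Metric.ball_subset_closedBall (hball σ t hσ ht))
      · refine hM _ (Metric.ball_subset_closedBall ?_)
        simpa using hball (-σ) t (by rwa [abs_neg]) ht
    · refine (ae_restrict_iff' measurableSet_Icc).mpr (Eventually.of_forall fun t ht => ?_)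
      have hz : (0 + Complex.I * t : ℂ) ∈ Metric.ball (0 : ℂ) (R + 1) := by
        simpa using hball 0 t (by simp) ht
      have hc : ContinuousAt (logDeriv g) (0 + Complex.I * t) :=
        (hcont.mono Metric.ball_subset_closedBall).continuousAt (Metric.isOpen_ball.mem_nhds hz)
      have h1 : Tendsto (fun σ : ℝ => (σ + Complex.I * t : ℂ)) (𝓝[>] 0)
          (𝓝 (0 + Complex.I * t)) := by
        have : Continuous fun σ : ℝ => (σ + Complex.I * t : ℂ) := by fun_prop
        simpa using (this.tendsto 0).mono_left nhdsWithin_le_nhds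
      have h2 : Tendsto (fun σ : ℝ => (-σ + Complex.I * t : ℂ)) (𝓝[>] 0)
          (𝓝 (0 + Complex.I * t)) := by
        have : Continuous fun σ : ℝ => (-σ + Complex.I * t : ℂ) := by fun_prop
        simpa using (this.tendsto 0).mono_left nhdsWithin_le_nhds
      have h3 := ((hc.tendsto.comp h1).sub (hc.tendsto.comp h2)).const_mul (φ t)
      rw [sub_self, mul_zero] at h3
      exact h3
  have hval : (2 * Real.pi * ∑ᶠ γ : ℝ, (analyticOrderNatAt F (Complex.I * γ) : ℂ) * φ γ) =
      ∑ u ∈ Z, (analyticOrderNatAt F u : ℂ) * (2 * Real.pi * φ u.im) + 0 := by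
    have himInj : Set.InjOn Complex.im (Z : Set ℂ) := fun u hu v hv h => by
      rw [hZim u hu, hZim v hv, h]
    rw [finsum_eq_sum_of_support_subset (s := Z.image Complex.im), Finset.sum_image himInj,
      Finset.mul_sum, add_zero]
    · refine Finset.sum_congr rfl fun u hu => ?_
      rw [← hZim u hu]
      ring
    · intro γ hγ
      have hγ' : analyticOrderNatAt F (Complex.I * γ) ≠ 0 ∧ φ γ ≠ 0 := by simpa using hγ
      rw [Finset.coe_image]
      refine ⟨Complex.I * γ, (hZ _).mpr ⟨?_, ?_⟩, by simp⟩
      · have hγR : γ ∈ Set.Icc (-R) R := by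
          by_contra h
          exact hγ'.2 (hφ0 γ h)
        simpa using Metric.ball_subset_closedBall (hball 0 γ (by simp) hγR)
      · exact (one_le_analyticOrderNatAt_iff hF hF1 _).mp (Nat.one_le_iff_ne_zero.mpr hγ'.1)
  rw [hval]
  refine (hpoisson.add hsmooth).congr' ?_
  filter_upwards [Ioo_mem_nhdsGT one_pos] with σ hσ
  exact (hsplit σ hσ.1 hσ.2).symm

end StableCrystalline

namespace StableCrystalline

open Filter Topology MeasureTheory

/-! ### The inverse Fourier transform -/

/-- `∫ φ(t) e^{-iλt} dt` -/
noncomputable def charIntegral (φ : ℝ → ℂ) (lam : ℝ) : ℂ :=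
  ∫ t : ℝ, φ t * Complex.exp (-(Complex.I * lam * t))

/-- The inverse of `fourierS`. -/
noncomputable def fourierSInv : 𝓢(ℝ, ℂ) →L[ℂ] 𝓢(ℝ, ℂ) :=
  (FourierTransform.fourierCLM ℂ 𝓢(ℝ, ℂ)).comp
    (SchwartzMap.compCLMOfContinuousLinearEquiv ℂ
      (ContinuousLinearEquiv.unitsEquivAut ℝ
        (Units.mk0 (2 * Real.pi) Real.two_pi_pos.ne')))

lemma fourierSInv_fourierS (h : 𝓢(ℝ, ℂ)) : fourierSInv (fourierS h) = h := by
  have h1 : (SchwartzMap.compCLMOfContinuousLinearEquiv ℂ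
      (ContinuousLinearEquiv.unitsEquivAut ℝ
        (Units.mk0 (2 * Real.pi) Real.two_pi_pos.ne'))) (fourierS h) =
      FourierTransformInv.fourierInv h := by
    ext t
    change FourierTransformInv.fourierInv h (t * (2 * Real.pi) * (2 * Real.pi)⁻¹) = _
    rw [mul_assoc, mul_inv_cancel₀ Real.two_pi_pos.ne', mul_one]
  change FourierTransform.fourier ((SchwartzMap.compCLMOfContinuousLinearEquiv ℂ
      (ContinuousLinearEquiv.unitsEquivAut ℝ
        (Units.mk0 (2 * Real.pi) Real.two_pi_pos.ne'))) (fourierS h)) = h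
  rw [h1, FourierTransform.fourier_fourierInv_eq]

lemma charIntegral_eq_fourierSInv (φ : 𝓢(ℝ, ℂ)) (lam : ℝ) :
    charIntegral φ lam = 2 * Real.pi * fourierSInv φ lam := by
  have h1 : fourierSInv φ lam =
      FourierTransform.fourier (fun t : ℝ => φ (t * (2 * Real.pi))) lam := by
    change FourierTransform.fourier (_ : 𝓢(ℝ, ℂ)) lam = _
    rw [SchwartzMap.fourier_coe]
    rfl
  rw [h1, Real.fourier_eq']
  have h2 := Measure.integral_comp_mul_right
    (fun t : ℝ => φ t * Complex.exp (-(Complex.I * lam * t))) (2 * Real.pi)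
  rw [abs_of_pos (inv_pos.mpr Real.two_pi_pos),
    eq_inv_smul_iff₀ Real.two_pi_pos.ne', Complex.real_smul] at h2
  rw [charIntegral, ← h2]
  push_cast
  congr 1
  refine integral_congr_ae (Eventually.of_forall fun t => ?_)
  simp only [smul_eq_mul, RCLike.inner_apply, conj_trivial]
  rw [mul_comm]
  congr 2
  push_cast
  ring

/-- Translation contributes only a phase. Both the uniform count of zeros and almost periodicity
rely on this. -/
lemma charIntegral_comp_sub (φ : ℝ → ℂ) (x lam : ℝ) :
    charIntegral (fun t => φ (t - x)) lam =
      Complex.exp (-(Complex.I * lam * x)) * charIntegral φ lam := by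
  rw [charIntegral, ← integral_add_right_eq_self _ x, charIntegral, ← integral_const_mul]
  refine integral_congr_ae (Eventually.of_forall fun t => ?_)
  simp only [add_sub_cancel_right]
  rw [mul_left_comm, ← Complex.exp_add]
  congr 2
  push_cast
  ring

/-! ### The spectral side -/

lemma hasSum_of_forall_eq {ι : Type*} {f g : ι → ℂ} {a : ℂ} (h : HasSum f a)
    (hfg : ∀ i, g i = f i) : HasSum g a := by
  rwa [funext hfg]

/-- Indices of the point masses of the Fourier transform. -/
abbrev SpectralIndex (n : ℕ) : Type := Unit ⊕ ((Fin n →₀ ℕ) ⊕ (Fin n →₀ ℕ))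

/-- The masses of the Fourier transform. -/
noncomputable def spectralMass {n : ℕ} (P Q : MvPolynomial (Fin n) ℂ) (ℓ : Fin n → ℕ)
    (b : Fin n → ℝ) : SpectralIndex n → ℂ :=
  Sum.elim (fun _ => (logDot b ℓ : ℂ))
    (Sum.elim (fun k => -((logDot b k : ℂ) * logCoeff P k))
      (fun k => -((logDot b k : ℂ) * logCoeff Q k)))

/-- The positions of the masses of the Fourier transform. -/
noncomputable def spectralPoint {n : ℕ} (b : Fin n → ℝ) : SpectralIndex n → ℝ :=
  Sum.elim (fun _ => 0) (Sum.elim (fun k => logDot b k) (fun k => -logDot b k))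

section

variable {n : ℕ} {P Q : MvPolynomial (Fin n) ℂ} {ℓ : Fin n → ℕ} {η : ℂ} {b : Fin n → ℝ}

lemma summable_spectralMass (hPQ : IsStablePair P Q ℓ η) (hb : ∀ j, 1 < b j) :
    Summable fun i => ‖spectralMass P Q ℓ b i‖ * ((1 + |spectralPoint b i|) ^ (2 * n))⁻¹ := by
  have aux : ∀ R : MvPolynomial (Fin n) ℂ, IsDStable R →
      Summable fun k : Fin n →₀ ℕ => ‖-((logDot b k : ℂ) * logCoeff R k)‖ *
        ((1 + |logDot b k|) ^ (2 * n))⁻¹ := fun R hR => by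
    obtain ⟨C, hC0, hC⟩ := exists_norm_logDot_mul_logCoeff_le hR hb
    refine Summable.of_nonneg_of_le (fun k => by positivity) (fun k => ?_)
      ((summable_one_add_logDot hb).mul_left C)
    rw [norm_neg, abs_of_nonneg (logDot_nonneg hb k)]
    have := logDot_nonneg hb k
    exact mul_le_mul_of_nonneg_right (hC k) (by positivity)
  refine Summable.sum _ Summable.of_finite (Summable.sum _ ?_ ?_)
  · exact aux P hPQ.stable_left
  · simpa [spectralMass, spectralPoint, Function.comp_def] using aux Q hPQ.stable_right

lemma finite_spectralPoint (hb : ∀ j, 1 < b j) (R : ℝ) :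
    {i : SpectralIndex n | |spectralPoint b i| ≤ R}.Finite := by
  have h := finite_logDot_le hb R
  refine ((Set.finite_range (Sum.inl : Unit → SpectralIndex n)).union
    ((h.image (Sum.inr ∘ Sum.inl)).union (h.image (Sum.inr ∘ Sum.inr)))).subset ?_
  rintro (i | k | k) hi
  · exact Or.inl ⟨i, rfl⟩
  · exact Or.inr (Or.inl ⟨k, (le_abs_self (logDot b k)).trans hi, rfl⟩)
  · refine Or.inr (Or.inr ⟨k, (le_abs_self (logDot b k)).trans ?_, rfl⟩)
    simpa [spectralPoint] using hi

lemma norm_exp_neg_I_mul (x y : ℝ) : ‖Complex.exp (-(Complex.I * x * y))‖ = 1 := by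
  rw [Complex.norm_exp]
  simp

/-- Since `-σ + it = -(σ - it)`, the left boundary value is governed by the series of `Q` at `σ -
it`, which places its frequencies at `-ξ·k`. -/
lemma hasSum_spectral_logDerivJump (hPQ : IsStablePair P Q ℓ η) (hb : ∀ j, 1 < b j) {σ : ℝ}
    (hσ : 0 < σ) (t : ℝ) :
    HasSum (fun i => spectralMass P Q ℓ b i * Real.exp (-(|spectralPoint b i| * σ)) *
      Complex.exp (-(Complex.I * spectralPoint b i * t)))
      (logDerivJump (dirichletPoly P b) σ t) := by
  have hp := hPQ.stable_left.hasSum_logDeriv hb (s := σ + Complex.I * t) (by simpa using hσ)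
  have hq := hPQ.stable_right.hasSum_logDeriv hb (s := σ - Complex.I * t) (by simpa using hσ)
  have hn := hPQ.logDeriv_neg hb (s := σ - Complex.I * t) (by simpa using hσ)
  have hJ : logDerivJump (dirichletPoly P b) σ t = (logDot b ℓ : ℂ) +
      (- -logDeriv (dirichletPoly P b) (σ + Complex.I * t) +
        - -logDeriv (dirichletPoly Q b) (σ - Complex.I * t)) := by
    rw [logDerivJump, show (-σ + Complex.I * t : ℂ) = -(σ - Complex.I * t) by ring, hn]
    ring
  rw [hJ]
  refine HasSum.sum ?_ (HasSum.sum ?_ ?_)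
  · refine hasSum_of_forall_eq (hasSum_unique fun _ : Unit => (logDot b ℓ : ℂ)) fun i => ?_
    simp [spectralMass, spectralPoint]
  · refine hasSum_of_forall_eq hp.neg fun k => ?_
    simp only [spectralMass, spectralPoint, Function.comp_apply, Sum.elim_inr, Sum.elim_inl,
      abs_of_nonneg (logDot_nonneg hb k)]
    rw [mul_assoc, Complex.ofReal_exp, ← Complex.exp_add, neg_mul]
    congr 3
    push_cast
    ring
  · refine hasSum_of_forall_eq hq.neg fun k => ?_
    simp only [spectralMass, spectralPoint, Function.comp_apply, Sum.elim_inr, abs_neg,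
      abs_of_nonneg (logDot_nonneg hb k)]
    rw [mul_assoc, Complex.ofReal_exp, ← Complex.exp_add, neg_mul]
    congr 3
    push_cast
    ring

lemma summable_spectralMass_mul_exp (hPQ : IsStablePair P Q ℓ η) (hb : ∀ j, 1 < b j) {σ : ℝ}
    (hσ : 0 < σ) :
    Summable fun i => ‖spectralMass P Q ℓ b i‖ * Real.exp (-(|spectralPoint b i| * σ)) := by
  have h := (hasSum_spectral_logDerivJump hPQ hb hσ 0).summable.norm
  refine h.congr fun i => ?_
  rw [norm_mul, norm_mul, norm_exp_neg_I_mul, mul_one, Complex.norm_real,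
    Real.norm_of_nonneg (Real.exp_pos _).le]

/-- The damping `e^{-|λ|σ}` makes the series absolutely summable uniformly in `t`, so termwise
integration is allowed. -/
lemma hasSum_integral_mul_logDerivJump (hPQ : IsStablePair P Q ℓ η) (hb : ∀ j, 1 < b j)
    {φ : ℝ → ℂ} (hφ : Integrable φ) {σ : ℝ} (hσ : 0 < σ) :
    HasSum (fun i => spectralMass P Q ℓ b i * Real.exp (-(|spectralPoint b i| * σ)) *
      charIntegral φ (spectralPoint b i))
      (∫ t, φ t * logDerivJump (dirichletPoly P b) σ t) := by
  set f : SpectralIndex n → ℝ → ℂ := fun i t =>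
    spectralMass P Q ℓ b i * Real.exp (-(|spectralPoint b i| * σ)) *
      (φ t * Complex.exp (-(Complex.I * spectralPoint b i * t))) with hf
  have hint : ∀ lam : ℝ, Integrable fun t => φ t * Complex.exp (-(Complex.I * lam * t)) :=
    fun lam => hφ.mul_bdd (c := 1) (Continuous.aestronglyMeasurable (by fun_prop))
      (Eventually.of_forall fun t => (norm_exp_neg_I_mul lam t).le)
  have hnorm : ∀ i, ∫ t, ‖f i t‖ = ‖spectralMass P Q ℓ b i‖ *
      Real.exp (-(|spectralPoint b i| * σ)) * ∫ t, ‖φ t‖ := fun i => by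
    rw [← integral_const_mul]
    refine integral_congr_ae (Eventually.of_forall fun t => ?_)
    simp only [hf, norm_mul, norm_exp_neg_I_mul, mul_one, Complex.norm_real,
      Real.norm_of_nonneg (Real.exp_pos _).le]
  have h := hasSum_integral_of_summable_integral_norm (F := f) (μ := volume)
    (fun i => (hint _).const_mul _)
    (by simpa only [hnorm] using (summable_spectralMass_mul_exp hPQ hb hσ).mul_right _)
  have h2 : ∫ t, ∑' i, f i t = ∫ t, φ t * logDerivJump (dirichletPoly P b) σ t := by
    refine integral_congr_ae (Eventually.of_forall fun t => ?_)
    refine HasSum.tsum_eq ?_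
    refine hasSum_of_forall_eq ((hasSum_spectral_logDerivJump hPQ hb hσ t).mul_left (φ t))
      fun i => ?_
    simp only [hf]
    ring
  rw [← h2]
  refine hasSum_of_forall_eq h fun i => ?_
  simp only [hf, charIntegral]
  rw [integral_const_mul]

/-- The summation formula for smooth test functions of compact support. -/
lemma hasSum_charIntegral_spectral (hPQ : IsStablePair P Q ℓ η) (hb : ∀ j, 1 < b j)
    {φ : ℝ → ℂ} (hφ : ContDiff ℝ (⊤ : ℕ∞) φ) (hs : HasCompactSupport φ) :
    Summable (fun i => ‖spectralMass P Q ℓ b i * charIntegral φ (spectralPoint b i)‖) ∧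
    HasSum (fun i => spectralMass P Q ℓ b i * charIntegral φ (spectralPoint b i))
      (2 * Real.pi * ∑ᶠ γ : ℝ, (zeroMult P b γ : ℂ) * φ γ) := by
  have hsum : Summable fun i =>
      ‖spectralMass P Q ℓ b i * charIntegral φ (spectralPoint b i)‖ := by
    have h := summable_mul_schwartz (summable_spectralMass hPQ hb)
      (fourierSInv (hs.toSchwartzMap hφ))
    have h2 := h.mul_left ‖(2 * Real.pi : ℂ)‖
    refine h2.congr fun i => ?_
    rw [← norm_mul, mul_left_comm, ← charIntegral_eq_fourierSInv]
    rfl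
  refine ⟨hsum, ?_⟩
  have h1 := tendsto_integral_mul_logDerivJump (differentiable_dirichletPoly P hb)
    (fun z hz => hPQ.dirichletPoly_left_ne_zero hb hz) hφ.continuous hs
  -- Removal of the damping: `charIntegral φ` is a Schwartz function, so the undamped series
  -- converges absolutely and dominates.
  have h2 : Tendsto (fun σ : ℝ => ∑' i, spectralMass P Q ℓ b i *
      Real.exp (-(|spectralPoint b i| * σ)) * charIntegral φ (spectralPoint b i)) (𝓝[>] 0)
      (𝓝 (∑' i, spectralMass P Q ℓ b i * charIntegral φ (spectralPoint b i))) := by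
    refine tendsto_tsum_of_dominated_convergence hsum (fun i => ?_) ?_
    · have hc : Continuous fun σ : ℝ => spectralMass P Q ℓ b i *
          (Real.exp (-(|spectralPoint b i| * σ)) : ℂ) * charIntegral φ (spectralPoint b i) := by
        fun_prop
      simpa using (hc.tendsto 0).mono_left nhdsWithin_le_nhds
    · filter_upwards [self_mem_nhdsWithin] with σ hσ i
      rw [mul_right_comm, norm_mul _ ((Real.exp _ : ℝ) : ℂ), Complex.norm_real,
        Real.norm_of_nonneg (Real.exp_pos _).le]
      refine mul_le_of_le_one_right (norm_nonneg _) (Real.exp_le_one_iff.mpr ?_)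
      have : 0 ≤ |spectralPoint b i| * σ := mul_nonneg (abs_nonneg _) (le_of_lt hσ)
      linarith
  have h3 : Tendsto (fun σ : ℝ => ∫ t, φ t * logDerivJump (dirichletPoly P b) σ t) (𝓝[>] 0)
      (𝓝 (∑' i, spectralMass P Q ℓ b i * charIntegral φ (spectralPoint b i))) := by
    refine h2.congr' ?_
    filter_upwards [self_mem_nhdsWithin] with σ hσ
    exact (hasSum_integral_mul_logDerivJump hPQ hb
      (hφ.continuous.integrable_of_hasCompactSupport hs) hσ).tsum_eq
  have h4 := tendsto_nhds_unique h1 h3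
  simp only [zeroMult]
  rw [h4]
  exact hsum.of_norm.hasSum

end

end StableCrystalline

namespace StableCrystalline

open Filter Topology MeasureTheory

section

variable {n : ℕ} {P Q : MvPolynomial (Fin n) ℂ} {ℓ : Fin n → ℕ} {η : ℂ} {b : Fin n → ℝ}

/-! ### The zeros and the measure they carry -/

lemma IsStablePair.one_le_zeroMult_iff (hPQ : IsStablePair P Q ℓ η) (hb : ∀ j, 1 < b j) (γ : ℝ) :
    1 ≤ zeroMult P b γ ↔ γ ∈ zeroSet P b :=
  one_le_analyticOrderNatAt_iff (differentiable_dirichletPoly P hb)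
    (hPQ.dirichletPoly_left_ne_zero hb (s := 1) (by simp)) _

lemma IsStablePair.support_zeroMult (hPQ : IsStablePair P Q ℓ η) (hb : ∀ j, 1 < b j) :
    Function.support (fun γ => (zeroMult P b γ : ℂ)) = zeroSet P b := by
  ext γ
  rw [← hPQ.one_le_zeroMult_iff hb, Function.mem_support, Nat.cast_ne_zero,
    Nat.one_le_iff_ne_zero]

lemma IsStablePair.finite_zeroSet_inter (hPQ : IsStablePair P Q ℓ η) (hb : ∀ j, 1 < b j) (R : ℝ) :
    (zeroSet P b ∩ Set.Icc (-R) R).Finite := by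
  obtain ⟨Z, -, hZ, -⟩ := exists_logDeriv_eq_sum_add (differentiable_dirichletPoly P hb)
    (hPQ.dirichletPoly_left_ne_zero hb (s := 1) (by simp)) R
  refine (Z.finite_toSet.preimage (f := fun γ : ℝ => Complex.I * (γ : ℂ))
    (fun x _ y _ h => by simpa using h)).subset fun γ hγ => ?_
  refine (hZ _).mpr ⟨?_, hγ.1⟩
  rw [mem_closedBall_zero_iff, norm_mul, Complex.norm_I, one_mul, Complex.norm_real,
    Real.norm_eq_abs]
  exact abs_le.mpr hγ.2

lemma IsStablePair.countable_zeroSet (hPQ : IsStablePair P Q ℓ η) (hb : ∀ j, 1 < b j) :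
    (zeroSet P b).Countable := by
  refine (Set.countable_iUnion fun m : ℕ => (hPQ.finite_zeroSet_inter hb m).countable).mono
    fun γ hγ => ?_
  obtain ⟨m, hm⟩ := exists_nat_ge |γ|
  exact Set.mem_iUnion.mpr ⟨m, hγ, abs_le.mp hm⟩

lemma IsStablePair.finite_support_zeroMult_mul (hPQ : IsStablePair P Q ℓ η) (hb : ∀ j, 1 < b j)
    {φ : ℝ → ℂ} (hs : HasCompactSupport φ) :
    (Function.support fun γ : ℝ => (zeroMult P b γ : ℂ) * φ γ).Finite := by
  obtain ⟨B, hB⟩ := hs.isBounded.subset_closedBall 0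
  rw [Real.closedBall_eq_Icc, zero_sub, zero_add] at hB
  refine (hPQ.finite_zeroSet_inter hb B).subset fun γ hγ => ?_
  rw [Function.mem_support] at hγ
  refine ⟨?_, hB (subset_tsupport _ (right_ne_zero_of_mul hγ))⟩
  rw [← hPQ.support_zeroMult hb]
  exact left_ne_zero_of_mul hγ

/-- The number of zeros in an interval is bounded in terms of its length. -/
lemma IsStablePair.exists_sum_zeroMult_le (hPQ : IsStablePair P Q ℓ η) (hb : ∀ j, 1 < b j)
    {R : ℝ} (hR : 0 < R) :
    ∃ C : ℝ, 0 ≤ C ∧ ∀ (x : ℝ) (s : Finset ℝ), (∀ γ ∈ s, |γ - x| ≤ R) →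
      ∑ γ ∈ s, (zeroMult P b γ : ℝ) ≤ C := by
  let χ : ContDiffBump (0 : ℝ) := ⟨R, R + 1, hR, lt_add_one R⟩
  set φ : ℝ → ℝ → ℂ := fun x γ => (χ (γ - x) : ℂ) with hφd
  have hφ : ∀ x, ContDiff ℝ (⊤ : ℕ∞) (φ x) := fun x =>
    Complex.ofRealCLM.contDiff.comp (χ.contDiff.comp (contDiff_id.sub contDiff_const))
  have hφs : ∀ x, HasCompactSupport (φ x) := fun x =>
    (χ.hasCompactSupport.comp_homeomorph (Homeomorph.subRight x)).comp_left Complex.ofReal_zero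
  have hsum := (hasSum_charIntegral_spectral hPQ hb (hφ 0) (hφs 0)).1
  refine ⟨(2 * Real.pi)⁻¹ * ∑' i, ‖spectralMass P Q ℓ b i *
    charIntegral (φ 0) (spectralPoint b i)‖, by positivity, fun x s hs => ?_⟩
  have hx := (hasSum_charIntegral_spectral hPQ hb (hφ x) (hφs x)).2
  -- The translates of the bump have spectral terms of equal modulus, so the bound at `x = 0` serves
  -- for all `x`.
  have hnorm : ∀ i, ‖spectralMass P Q ℓ b i * charIntegral (φ x) (spectralPoint b i)‖ =
      ‖spectralMass P Q ℓ b i * charIntegral (φ 0) (spectralPoint b i)‖ := fun i => by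
    have h1 : φ x = fun t => φ 0 (t - x) := by
      ext t
      simp [hφd]
    rw [h1, charIntegral_comp_sub, norm_mul, norm_mul, norm_exp_neg_I_mul, one_mul, ← norm_mul]
  have hle : ‖(2 * Real.pi * ∑ᶠ γ : ℝ, (zeroMult P b γ : ℂ) * φ x γ : ℂ)‖ ≤
      ∑' i, ‖spectralMass P Q ℓ b i * charIntegral (φ 0) (spectralPoint b i)‖ := by
    rw [← hx.tsum_eq]
    refine (norm_tsum_le_tsum_norm (hsum.congr fun i => (hnorm i).symm)).trans ?_
    rw [tsum_congr hnorm]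
  have hfin := hPQ.finite_support_zeroMult_mul hb (hφs x)
  rw [finsum_eq_sum_of_support_subset (s := s ∪ hfin.toFinset) _ (by simp)] at hle
  have hreal : (2 * Real.pi * ∑ γ ∈ s ∪ hfin.toFinset, (zeroMult P b γ : ℂ) * φ x γ : ℂ) =
      ((2 * Real.pi * ∑ γ ∈ s ∪ hfin.toFinset, (zeroMult P b γ : ℝ) * χ (γ - x) : ℝ) : ℂ) := by
    push_cast
    rfl
  have hnn : ∀ γ, 0 ≤ (zeroMult P b γ : ℝ) * χ (γ - x) := fun γ =>
    mul_nonneg (Nat.cast_nonneg _) χ.nonneg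
  rw [hreal, Complex.norm_real, Real.norm_of_nonneg
    (mul_nonneg Real.two_pi_pos.le (Finset.sum_nonneg fun γ _ => hnn γ))] at hle
  rw [← div_eq_inv_mul, le_div_iff₀' Real.two_pi_pos]
  refine le_trans (mul_le_mul_of_nonneg_left ?_ Real.two_pi_pos.le) hle
  calc ∑ γ ∈ s, (zeroMult P b γ : ℝ) = ∑ γ ∈ s, (zeroMult P b γ : ℝ) * χ (γ - x) := by
        refine Finset.sum_congr rfl fun γ hγ => ?_
        rw [χ.one_of_mem_closedBall (by simpa using hs γ hγ), mul_one]
    _ ≤ _ := Finset.sum_le_sum_of_subset_of_nonneg Finset.subset_union_left fun γ _ _ => hnn γ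

lemma summable_int_one_add_abs_sq : Summable fun N : ℤ => ((1 + |(N : ℝ)|) ^ 2)⁻¹ := by
  have h1 := summable_nat_one_add_sq
  refine Summable.of_nat_of_neg (h1.congr fun m => ?_) (h1.congr fun m => ?_) <;> simp

/-- Grouping by integer part, each group has total multiplicity at most `C`; the factor 4 is the
square of the 2 in `1 + |⌊γ⌋| ≤ 2(1 + |γ|)`. -/
lemma IsStablePair.summable_zeroMult (hPQ : IsStablePair P Q ℓ η) (hb : ∀ j, 1 < b j) :
    Summable fun γ : ℝ => (zeroMult P b γ : ℝ) * ((1 + |γ|) ^ 2)⁻¹ := by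
  obtain ⟨C, hC0, hC⟩ := hPQ.exists_sum_zeroMult_le hb one_pos
  refine summable_of_sum_le (c := ∑' N : ℤ, C * (4 * ((1 + |(N : ℝ)|) ^ 2)⁻¹))
    (fun γ => by positivity) fun A => ?_
  have hsum : Summable fun N : ℤ => C * (4 * ((1 + |(N : ℝ)|) ^ 2)⁻¹) :=
    (summable_int_one_add_abs_sq.mul_left 4).mul_left C
  have hfloor : ∀ γ : ℝ, |γ - (⌊γ⌋ : ℝ)| ≤ 1 := fun γ => by
    rw [abs_le]
    constructor <;> linarith [Int.floor_le γ, Int.lt_floor_add_one γ]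
  rw [← Finset.sum_fiberwise_of_maps_to (g := fun γ : ℝ => ⌊γ⌋)
    (t := A.image fun γ : ℝ => ⌊γ⌋) fun γ hγ => Finset.mem_image_of_mem _ hγ]
  refine le_trans (Finset.sum_le_sum fun N _ => ?_) (hsum.sum_le_tsum
    (A.image fun γ : ℝ => ⌊γ⌋) fun N _ => by positivity)
  calc ∑ γ ∈ A with ⌊γ⌋ = N, (zeroMult P b γ : ℝ) * ((1 + |γ|) ^ 2)⁻¹
      ≤ ∑ γ ∈ A with ⌊γ⌋ = N, (zeroMult P b γ : ℝ) * (4 * ((1 + |(N : ℝ)|) ^ 2)⁻¹) := by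
        refine Finset.sum_le_sum fun γ hγ => mul_le_mul_of_nonneg_left ?_ (Nat.cast_nonneg _)
        have hN : |γ - (N : ℝ)| ≤ 1 := by
          rw [← (Finset.mem_filter.mp hγ).2]
          exact hfloor γ
        have h1 : 1 + |(N : ℝ)| ≤ 2 * (1 + |γ|) := by
          have h2 : |(N : ℝ)| ≤ |γ| + |γ - N| := by
            have := abs_sub γ (γ - N)
            simpa using this
          linarith [abs_nonneg γ]
        rw [← div_eq_mul_inv, inv_eq_one_div, div_le_div_iff₀ (by positivity) (by positivity)]
        nlinarith [pow_le_pow_left₀ (by positivity) h1 2]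
    _ = (∑ γ ∈ A with ⌊γ⌋ = N, (zeroMult P b γ : ℝ)) * (4 * ((1 + |(N : ℝ)|) ^ 2)⁻¹) := by
        rw [Finset.sum_mul]
    _ ≤ C * (4 * ((1 + |(N : ℝ)|) ^ 2)⁻¹) := by
        refine mul_le_mul_of_nonneg_right (hC N _ fun γ hγ => ?_) (by positivity)
        rw [← (Finset.mem_filter.mp hγ).2]
        exact hfloor γ

lemma IsStablePair.hasSum_zeroMeasure (hPQ : IsStablePair P Q ℓ η) (hb : ∀ j, 1 < b j)
    {φ : ℝ → ℂ} (h : Summable fun γ : ℝ => (zeroMult P b γ : ℝ) * ‖φ γ‖) :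
    Integrable φ (zeroMeasure P b) ∧
      HasSum (fun γ : zeroSet P b => (zeroMult P b γ : ℂ) * φ γ) (∫ x, φ x ∂(zeroMeasure P b)) := by
  have : Countable (zeroSet P b) := (hPQ.countable_zeroSet hb).to_subtype
  have hint : Integrable φ (zeroMeasure P b) :=
    integrable_sum_dirac (fun γ => ENNReal.natCast_ne_top _)
      ((h.comp_injective (Subtype.val_injective (p := (· ∈ zeroSet P b)))).congr
        fun γ => by simp)
  refine ⟨hint, hasSum_of_forall_eq (hasSum_integral_measure hint) fun γ => ?_⟩
  rw [integral_smul_measure, integral_dirac]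
  simp

lemma IsStablePair.isLocallyFiniteMeasure (hPQ : IsStablePair P Q ℓ η) (hb : ∀ j, 1 < b j) :
    IsLocallyFiniteMeasure (zeroMeasure P b) := by
  have hint := (hPQ.hasSum_zeroMeasure hb (φ := fun γ => ((((1 + |γ|) ^ 2)⁻¹ : ℝ) : ℂ)) (by
    refine (hPQ.summable_zeroMult hb).congr fun γ => ?_
    rw [Complex.norm_real, Real.norm_of_nonneg (by positivity)])).1
  refine ⟨fun x => ⟨Metric.ball x 1, Metric.ball_mem_nhds x one_pos, ?_⟩⟩
  refine (measure_mono fun y hy => ?_).trans_lt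
    (hint.measure_norm_ge_lt_top (ε := ((1 + (|x| + 1)) ^ 2)⁻¹) (by positivity))
  have h1 : |y| ≤ |x| + 1 := by
    have h2 : |y - x| < 1 := hy
    have := abs_sub_abs_le_abs_sub y x
    linarith
  change ((1 + (|x| + 1)) ^ 2)⁻¹ ≤ ‖((((1 + |y|) ^ 2)⁻¹ : ℝ) : ℂ)‖
  rw [Complex.norm_real, Real.norm_of_nonneg (by positivity)]
  gcongr

/-! ### The measure and its Fourier transform -/

/-- Let `T` be the sum over zeros and `S` the sum over spectral points. The formula for compactly
supported functions says `T = S ∘ fourierSInv` on a dense set, hence everywhere; evaluating at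
`fourierS h` gives the transform. -/
lemma IsStablePair.exists_temperedDistribution (hPQ : IsStablePair P Q ℓ η) (hb : ∀ j, 1 < b j) :
    ∃ T : 𝓢'(ℝ, ℂ),
      (∀ h : 𝓢(ℝ, ℂ), HasSum (fun γ : ℝ => (zeroMult P b γ : ℂ) * h γ) (T h)) ∧
      ∀ h : 𝓢(ℝ, ℂ), HasSum (fun i => spectralMass P Q ℓ b i * h (spectralPoint b i))
        (fourierT T h) := by
  obtain ⟨T, hT⟩ := exists_temperedDistribution_hasSum (a := fun γ : ℝ => (zeroMult P b γ : ℂ))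
    (x := fun γ => γ) (N := 2) (by simpa using hPQ.summable_zeroMult hb)
  obtain ⟨S, hS⟩ := exists_temperedDistribution_hasSum (summable_spectralMass hPQ hb)
  have hTS : (fun φ : 𝓢(ℝ, ℂ) => T φ) = fun φ => S (fourierSInv φ) := by
    refine Continuous.ext_on dense_hasCompactSupport_schwartz (map_continuous T)
      ((map_continuous S).comp fourierSInv.continuous) fun φ hφ => ?_
    have h1 := (hasSum_charIntegral_spectral hPQ hb (φ.smooth (⊤ : ℕ∞)) hφ).2
    have h2 := (hS (fourierSInv φ)).mul_left (2 * Real.pi : ℂ)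
    have h3 := h1.unique (hasSum_of_forall_eq h2 fun i => by
      rw [charIntegral_eq_fourierSInv, mul_left_comm])
    have h4 : T φ = ∑ᶠ γ : ℝ, (zeroMult P b γ : ℂ) * φ γ :=
      (isDiscreteSum_of_hasSum (fun R => by
        rw [hPQ.support_zeroMult hb]
        exact hPQ.finite_zeroSet_inter hb R) hT).2 φ hφ
    rw [← h4] at h3
    exact mul_left_cancel₀ (by exact_mod_cast Real.two_pi_pos.ne') h3
  refine ⟨T, hT, fun h => ?_⟩
  have h1 : fourierT T h = S h := by
    have := congrFun hTS (fourierS h)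
    simp only [fourierSInv_fourierS] at this
    rw [fourierT_apply, this]
  rw [h1]
  exact hS h

end

end StableCrystalline

namespace StableCrystalline

open Filter Topology MeasureTheory

/-! ### Bohr almost periodic functions -/

lemma isBohrAlmostPeriodic_of_approx {f : ℝ → ℂ}
    (h : ∀ ε : ℝ, 0 < ε → ∃ g, IsBohrAlmostPeriodic g ∧ ∀ t, ‖f t - g t‖ ≤ ε) :
    IsBohrAlmostPeriodic f := by
  refine ⟨?_, fun ε hε => ?_⟩
  · refine continuous_of_uniform_approx_of_continuous fun u hu => ?_
    obtain ⟨ε, hε, hεu⟩ := Metric.mem_uniformity_dist.mp hu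
    obtain ⟨g, hg, hfg⟩ := h (ε / 2) (half_pos hε)
    refine ⟨g, hg.1, fun y => hεu ?_⟩
    rw [dist_eq_norm]
    exact (hfg y).trans_lt (half_lt_self hε)
  · obtain ⟨g, hg, hfg⟩ := h (ε / 3) (by positivity)
    obtain ⟨L, hL, hτ⟩ := hg.2 (ε / 3) (by positivity)
    refine ⟨L, hL, fun x => ?_⟩
    obtain ⟨τ, hτx, hτg⟩ := hτ x
    refine ⟨τ, hτx, fun t => ?_⟩
    have h1 := hfg (t + τ)
    have h2 := hfg t
    rw [norm_sub_rev] at h2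
    calc ‖f (t + τ) - f t‖
        = ‖(f (t + τ) - g (t + τ)) + (g (t + τ) - g t) + (g t - f t)‖ := by ring_nf
      _ ≤ ‖f (t + τ) - g (t + τ)‖ + ‖g (t + τ) - g t‖ + ‖g t - f t‖ := norm_add₃_le
      _ ≤ ε := by linarith [hτg t]

/-- Finitely many characters have a relatively dense set of common almost periods. -/
lemma exists_common_almost_period {ι : Type*} (s : Finset ι) (x : ι → ℝ) {δ : ℝ} (hδ : 0 < δ) :
    ∃ L : ℝ, 0 < L ∧ ∀ y : ℝ, ∃ τ ∈ Set.Icc y (y + L), ∀ i ∈ s,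
      ‖Complex.exp (-(Complex.I * x i * τ)) - 1‖ ≤ δ := by
  set E : ℝ → (s → ℂ) := fun t i => Complex.exp (-(Complex.I * x i * t)) with hE
  have htb : TotallyBounded (Set.range E) := by
    refine (isCompact_closedBall (0 : s → ℂ) 1).totallyBounded.subset ?_
    rintro _ ⟨t, rfl⟩
    rw [mem_closedBall_zero_iff, pi_norm_le_iff_of_nonneg zero_le_one]
    exact fun i => (norm_exp_neg_I_mul _ _).le
  -- The orbit of the characters is bounded in a finite-dimensional space, hence has a finite
  -- `δ`-net of its own points `E (r v)`; differences of nearby times are almost periods.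
  obtain ⟨Y, hYE, hYf, hY⟩ := totallyBounded_iff_subset.mp htb _ (Metric.dist_mem_uniformity hδ)
  choose! r hr using fun y (hy : y ∈ Y) => hYE hy
  obtain ⟨B, hB⟩ := (hYf.image fun y => |r y|).bddAbove
  refine ⟨2 * (|B| + 1), by positivity, fun y => ?_⟩
  have hmem := hY (Set.mem_range_self (y + (|B| + 1)))
  simp only [Set.mem_iUnion] at hmem
  obtain ⟨v, hv, hdist⟩ := hmem
  have hrB : |r v| ≤ |B| + 1 :=
    (hB (Set.mem_image_of_mem _ hv)).trans ((le_abs_self B).trans (by linarith))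
  -- As `|r v| ≤ |B| + 1`, starting from the midpoint keeps the difference inside the interval of
  -- length `2(|B| + 1)`.
  refine ⟨y + (|B| + 1) - r v, ?_, fun i hi => ?_⟩
  · have := abs_le.mp hrB
    constructor <;> linarith [this.1, this.2]
  · have hd : dist (E (y + (|B| + 1))) v < δ := hdist
    rw [← hr v hv] at hd
    have h1 := (dist_le_pi_dist (E (y + (|B| + 1))) (E (r v)) ⟨i, hi⟩).trans hd.le
    rw [dist_eq_norm] at h1
    have h2 : E (y + (|B| + 1)) ⟨i, hi⟩ - E (r v) ⟨i, hi⟩ =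
        (Complex.exp (-(Complex.I * x i * (y + (|B| + 1) - r v : ℝ))) - 1) *
          Complex.exp (-(Complex.I * x i * r v)) := by
      rw [sub_mul, one_mul, ← Complex.exp_add]
      simp only [hE]
      congr 2
      push_cast
      ring
    rw [h2, norm_mul, norm_exp_neg_I_mul, mul_one] at h1
    exact h1

lemma isBohrAlmostPeriodic_finset_sum {ι : Type*} (s : Finset ι) (c : ι → ℂ) (x : ι → ℝ) :
    IsBohrAlmostPeriodic fun t => ∑ i ∈ s, c i * Complex.exp (-(Complex.I * x i * t)) := by
  refine ⟨by fun_prop, fun ε hε => ?_⟩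
  have hS : 0 ≤ ∑ i ∈ s, ‖c i‖ := Finset.sum_nonneg fun i _ => norm_nonneg _
  obtain ⟨L, hL, hτ⟩ := exists_common_almost_period s x
    (δ := ε / (1 + ∑ i ∈ s, ‖c i‖)) (by positivity)
  refine ⟨L, hL, fun y => ?_⟩
  obtain ⟨τ, hτy, hτs⟩ := hτ y
  refine ⟨τ, hτy, fun t => ?_⟩
  have h1 : ∀ i, c i * Complex.exp (-(Complex.I * x i * (t + τ : ℝ))) -
      c i * Complex.exp (-(Complex.I * x i * t)) =
      c i * Complex.exp (-(Complex.I * x i * t)) *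
        (Complex.exp (-(Complex.I * x i * τ)) - 1) := fun i => by
    rw [mul_sub, mul_one, mul_assoc (c i), ← Complex.exp_add]
    congr 3
    push_cast
    ring
  rw [← Finset.sum_sub_distrib]
  refine (norm_sum_le _ _).trans ?_
  calc ∑ i ∈ s, ‖c i * Complex.exp (-(Complex.I * x i * (t + τ : ℝ))) -
        c i * Complex.exp (-(Complex.I * x i * t))‖
      ≤ ∑ i ∈ s, ‖c i‖ * (ε / (1 + ∑ i ∈ s, ‖c i‖)) := by
        refine Finset.sum_le_sum fun i hi => ?_
        rw [h1, norm_mul, norm_mul, norm_exp_neg_I_mul, mul_one]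
        exact mul_le_mul_of_nonneg_left (hτs i hi) (norm_nonneg _)
    _ = (∑ i ∈ s, ‖c i‖) / (1 + ∑ i ∈ s, ‖c i‖) * ε := by
        rw [← Finset.sum_mul]
        ring
    _ ≤ 1 * ε := by
        refine mul_le_mul_of_nonneg_right ?_ hε.le
        rw [div_le_one₀ (by positivity)]
        linarith
    _ = ε := one_mul ε

/-- The tail of `∑ ‖c i‖` bounds the distance to a finite trigonometric sum uniformly in `t`. -/
lemma isBohrAlmostPeriodic_tsum {ι : Type*} {c : ι → ℂ} (hc : Summable fun i => ‖c i‖)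
    (x : ι → ℝ) :
    IsBohrAlmostPeriodic fun t => ∑' i, c i * Complex.exp (-(Complex.I * x i * t)) := by
  refine isBohrAlmostPeriodic_of_approx fun ε hε => ?_
  obtain ⟨s, hs⟩ := ((tendsto_order.mp (tendsto_tsum_compl_atTop_zero fun i => ‖c i‖)).2 ε hε).exists
  refine ⟨_, isBohrAlmostPeriodic_finset_sum s c x, fun t => ?_⟩
  have hn : ∀ i, ‖c i * Complex.exp (-(Complex.I * x i * t))‖ = ‖c i‖ := fun i => by
    rw [norm_mul, norm_exp_neg_I_mul, mul_one]
  have hsum : Summable fun i => ‖c i * Complex.exp (-(Complex.I * x i * t))‖ :=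
    hc.congr fun i => (hn i).symm
  rw [← hsum.of_norm.sum_add_tsum_subtype_compl s, add_sub_cancel_left]
  refine (norm_tsum_le_tsum_norm (hsum.subtype _)).trans ?_
  rw [tsum_congr fun i : {i // i ∉ s} => hn i]
  exact hs.le

/-! ### Almost periodicity of the zero measure -/

section

variable {n : ℕ} {P Q : MvPolynomial (Fin n) ℂ} {ℓ : Fin n → ℕ} {η : ℂ} {b : Fin n → ℝ}

lemma IsStablePair.integral_zeroMeasure (hPQ : IsStablePair P Q ℓ η) (hb : ∀ j, 1 < b j)
    {φ : ℝ → ℂ} (hs : HasCompactSupport φ) :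
    Integrable φ (zeroMeasure P b) ∧
      ∫ y, φ y ∂(zeroMeasure P b) = ∑ᶠ γ : ℝ, (zeroMult P b γ : ℂ) * φ γ := by
  have hfin := hPQ.finite_support_zeroMult_mul hb hs
  have hsum : Summable fun γ : ℝ => (zeroMult P b γ : ℝ) * ‖φ γ‖ := by
    refine (summable_of_hasFiniteSupport hfin).norm.congr fun γ => ?_
    rw [norm_mul, Complex.norm_natCast]
  obtain ⟨hint, h⟩ := hPQ.hasSum_zeroMeasure hb hsum
  refine ⟨hint, ?_⟩
  have h1 := (hasSum_subtype_iff_of_support_subset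
    (f := fun γ : ℝ => (zeroMult P b γ : ℂ) * φ γ) (s := zeroSet P b) ?_).mp h
  · rw [← h1.tsum_eq, tsum_eq_finsum hfin]
  · rw [← hPQ.support_zeroMult hb]
    exact Function.support_mul_subset_left _ _

lemma hasCompactSupport_const_sub {φ : ℝ → ℂ} (hs : HasCompactSupport φ) (x : ℝ) :
    HasCompactSupport fun y => φ (x - y) :=
  hs.comp_homeomorph (Homeomorph.subLeft x)

/-- The summation formula for `y ↦ φ (x - y)` depends on `x` only through phases, so the convolution
is an absolutely convergent trigonometric series in `x`. -/
lemma IsStablePair.isBohrAlmostPeriodic_of_contDiff (hPQ : IsStablePair P Q ℓ η)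
    (hb : ∀ j, 1 < b j) {φ : ℝ → ℂ} (hφ : ContDiff ℝ (⊤ : ℕ∞) φ) (hs : HasCompactSupport φ) :
    IsBohrAlmostPeriodic fun x => ∫ y, φ (x - y) ∂(zeroMeasure P b) := by
  set ψ : ℝ → ℂ := fun u => φ (0 - u) with hψ
  have hshift : ∀ x : ℝ, (fun y => φ (x - y)) = fun y => ψ (y - x) := fun x => by
    ext y
    simp [hψ]
  have hsmooth : ∀ x : ℝ, ContDiff ℝ (⊤ : ℕ∞) fun y => φ (x - y) := fun x =>
    hφ.comp (contDiff_const.sub contDiff_id)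
  have hψsum := (hasSum_charIntegral_spectral hPQ hb (hsmooth 0)
    (hasCompactSupport_const_sub hs 0)).1
  have h2pi : (2 * Real.pi : ℂ) ≠ 0 := by exact_mod_cast Real.two_pi_pos.ne'
  have hval : (fun x => ∫ y, φ (x - y) ∂(zeroMeasure P b)) = fun x : ℝ =>
      ∑' i, (2 * Real.pi : ℂ)⁻¹ * (spectralMass P Q ℓ b i * charIntegral ψ (spectralPoint b i)) *
        Complex.exp (-(Complex.I * spectralPoint b i * x)) := by
    ext x
    have h1 := (hasSum_charIntegral_spectral hPQ hb (hsmooth x)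
      (hasCompactSupport_const_sub hs x)).2
    rw [(hPQ.integral_zeroMeasure hb (hasCompactSupport_const_sub hs x)).2,
      ← inv_mul_cancel_left₀ h2pi (∑ᶠ γ : ℝ, _), ← h1.tsum_eq, ← tsum_mul_left]
    refine tsum_congr fun i => ?_
    rw [hshift, charIntegral_comp_sub]
    ring
  rw [hval]
  refine isBohrAlmostPeriodic_tsum ?_ _
  refine (hψsum.mul_left ‖(2 * Real.pi : ℂ)⁻¹‖).congr fun i => ?_
  rw [← norm_mul]

lemma exists_contDiff_approx_of_hasCompactSupport {φ : ℝ → ℂ} (hφ : Continuous φ)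
    (hs : HasCompactSupport φ) :
    ∃ R : ℝ, 0 < R ∧ (∀ t, R < |t| → φ t = 0) ∧ ∀ ε : ℝ, 0 < ε →
      ∃ g : ℝ → ℂ, ContDiff ℝ (⊤ : ℕ∞) g ∧ (∀ t, R < |t| → g t = 0) ∧ ∀ t, ‖φ t - g t‖ ≤ ε := by
  obtain ⟨B, hB⟩ := hs.isBounded.subset_closedBall 0
  have hφ0 : ∀ t, |B| < |t| → φ t = 0 := fun t ht => by
    refine image_eq_zero_of_notMem_tsupport fun h => ?_
    have := mem_closedBall_zero_iff.mp (hB h)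
    rw [Real.norm_eq_abs] at this
    exact absurd (ht.trans_le (this.trans (le_abs_self B))) (lt_irrefl _)
  -- Mollifying at scale at most 1 enlarges the support by at most 1, so this radius works for every
  -- `ε`.
  refine ⟨|B| + 1, by positivity, fun t ht => hφ0 t (by linarith), fun ε hε => ?_⟩
  obtain ⟨δ, hδ, hδφ⟩ := Metric.uniformContinuous_iff.mp
    (hs.uniformContinuous_of_continuous hφ) ε hε
  obtain ⟨g, hg, hgφ⟩ := hφ.exists_contDiff_dist_le_of_forall_mem_ball_dist_le
    (lt_min hδ one_pos)
  refine ⟨g, hg, fun t ht => ?_, fun t => ?_⟩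
  · have hz : ∀ y ∈ Metric.ball t (min δ 1), φ y = 0 := fun y hy => by
      refine hφ0 y ?_
      have h1 : |y - t| < 1 := (Metric.mem_ball.mp hy).trans_le (min_le_right _ _)
      have h2 := abs_sub_abs_le_abs_sub t y
      rw [abs_sub_comm] at h2
      linarith
    have h3 := hgφ t 0 fun y hy => by
      rw [hz y hy, hz t (Metric.mem_ball_self (lt_min hδ one_pos)), dist_self]
    rw [hz t (Metric.mem_ball_self (lt_min hδ one_pos)), dist_zero_right] at h3
    exact norm_le_zero_iff.mp h3
  · rw [← dist_eq_norm, dist_comm]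
    exact hgφ t ε fun y hy =>
      (hδφ ((Metric.mem_ball.mp hy).trans_le (min_le_left _ _))).le

/-- Only zeros within `R` of `x` enter the convolution at `x`, and their total multiplicity is at
most `C`. A uniform approximation of `φ` within `ε/(C + 1)` supported in the same interval thus
changes the convolution by at most `ε`. -/
theorem IsStablePair.isAlmostPeriodicMeasure (hPQ : IsStablePair P Q ℓ η) (hb : ∀ j, 1 < b j) :
    IsAlmostPeriodicMeasure (zeroMeasure P b) := by
  refine ⟨hPQ.isLocallyFiniteMeasure hb, fun φ hφ hs => ?_⟩
  obtain ⟨R, hR, hφR, happrox⟩ := exists_contDiff_approx_of_hasCompactSupport hφ hs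
  obtain ⟨C, hC0, hC⟩ := hPQ.exists_sum_zeroMult_le hb hR
  refine isBohrAlmostPeriodic_of_approx fun ε hε => ?_
  obtain ⟨g, hg, hgR, hφg⟩ := happrox (ε / (C + 1)) (by positivity)
  have hgs : HasCompactSupport g := by
    refine HasCompactSupport.intro (isCompact_closedBall (0 : ℝ) R) fun t ht => hgR t ?_
    simpa using ht
  refine ⟨_, hPQ.isBohrAlmostPeriodic_of_contDiff hb hg hgs, fun x => ?_⟩
  have hd : HasCompactSupport (φ - g) := hs.sub hgs
  have h1 := hPQ.integral_zeroMeasure hb (hasCompactSupport_const_sub hs x)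
  have h2 := hPQ.integral_zeroMeasure hb (hasCompactSupport_const_sub hgs x)
  have h3 := (hPQ.integral_zeroMeasure hb (hasCompactSupport_const_sub hd x)).2
  have hfin := hPQ.finite_support_zeroMult_mul hb (hasCompactSupport_const_sub hd x)
  rw [← integral_sub h1.1 h2.1]
  change ‖∫ y, (φ - g) (x - y) ∂(zeroMeasure P b)‖ ≤ ε
  rw [h3, finsum_eq_sum _ hfin]
  refine (norm_sum_le _ _).trans ?_
  calc ∑ γ ∈ hfin.toFinset, ‖(zeroMult P b γ : ℂ) * (φ - g) (x - γ)‖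
      ≤ ∑ γ ∈ hfin.toFinset, (zeroMult P b γ : ℝ) * (ε / (C + 1)) := by
        refine Finset.sum_le_sum fun γ _ => ?_
        rw [norm_mul, Complex.norm_natCast]
        exact mul_le_mul_of_nonneg_left (hφg _) (Nat.cast_nonneg _)
    _ = (∑ γ ∈ hfin.toFinset, (zeroMult P b γ : ℝ)) * (ε / (C + 1)) := by rw [Finset.sum_mul]
    _ ≤ C * (ε / (C + 1)) := by
        refine mul_le_mul_of_nonneg_right (hC x _ fun γ hγ => ?_) (by positivity)
        by_contra h
        rw [not_le, abs_sub_comm] at h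
        rw [Set.Finite.mem_toFinset, Function.mem_support] at hγ
        refine hγ ?_
        rw [Pi.sub_apply, hφR _ h, hgR _ h, sub_zero, mul_zero]
    _ ≤ ε := by
        rw [mul_div_assoc', div_le_iff₀ (by positivity)]
        nlinarith

end

end StableCrystalline

/-! ### Support of the transform and assembly of the theorem -/

namespace StableCrystalline

lemma massAt_spectral_support {n : ℕ} (a : SpectralIndex n → ℂ) (b : Fin n → ℝ) :
    Function.support (massAt a (spectralPoint b)) ⊆
      Lplus b ∪ {x | -x ∈ Lplus b} ∪ {0} := by
  intro t ht
  obtain ⟨i, rfl⟩ := exists_of_massAt_ne_zero ht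
  by_cases h0 : spectralPoint b i = 0
  · exact Or.inr h0
  · refine Or.inl ?_
    rcases i with i | k | k
    · exact absurd rfl h0
    · exact Or.inl ⟨⟨k, rfl⟩, h0⟩
    · exact Or.inr ⟨⟨k, neg_neg _⟩, by simpa using h0⟩

/-- Splits the sum over the three kinds of spectral index. The sums may include `k = 0`, whose term
vanishes because `ξ·0 = 0`. -/
lemma summable_and_eq_of_hasSum_spectral {n : ℕ} {P Q : MvPolynomial (Fin n) ℂ} {ℓ : Fin n → ℕ}
    {b : Fin n → ℝ} {h : ℝ → ℂ} {A : ℂ}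
    (hA : HasSum (fun i => spectralMass P Q ℓ b i * h (spectralPoint b i)) A) :
    Summable (fun k : Fin n →₀ ℕ => (logDot b k : ℂ) * logCoeff P k * h (logDot b k)) ∧
    Summable (fun k : Fin n →₀ ℕ => (logDot b k : ℂ) * logCoeff Q k * h (-logDot b k)) ∧
    A = (logDot b ℓ : ℂ) * h 0
      - (∑' k : Fin n →₀ ℕ, (logDot b k : ℂ) * logCoeff P k * h (logDot b k))
      - (∑' k : Fin n →₀ ℕ, (logDot b k : ℂ) * logCoeff Q k * h (-logDot b k)) := by
  have hr := hA.summable.comp_injective Sum.inr_injective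
  have hP := (hr.comp_injective Sum.inl_injective).neg.congr
    (g := fun k : Fin n →₀ ℕ => (logDot b k : ℂ) * logCoeff P k * h (logDot b k))
    fun k => by simp [spectralMass, spectralPoint]
  have hQ := (hr.comp_injective Sum.inr_injective).neg.congr
    (g := fun k : Fin n →₀ ℕ => (logDot b k : ℂ) * logCoeff Q k * h (-logDot b k))
    fun k => by simp [spectralMass, spectralPoint]
  refine ⟨hP, hQ, hA.unique ?_⟩
  rw [sub_eq_add_neg, sub_eq_add_neg, add_assoc]
  refine HasSum.sum ?_ (HasSum.sum ?_ ?_)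
  · exact hasSum_of_forall_eq (hasSum_unique fun _ : Unit => (logDot b ℓ : ℂ) * h 0)
      fun i => by simp [spectralMass, spectralPoint]
  · exact hasSum_of_forall_eq hP.hasSum.neg fun k => by simp [spectralMass, spectralPoint]
  · exact hasSum_of_forall_eq hQ.hasSum.neg fun k => by simp [spectralMass, spectralPoint]

end StableCrystalline

theorem theorem1 {n : ℕ} (P Q : MvPolynomial (Fin n) ℂ) (ℓ : Fin n → ℕ) (η : ℂ)
    (hPQ : IsStablePair P Q ℓ η) (b : Fin n → ℝ) (hb : ∀ j, 1 < b j) :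
    -- all zeros of `F` lie on the imaginary axis
    (∀ s : ℂ, dirichletPoly P b s = 0 → s.re = 0) ∧
    ∃ T : 𝓢'(ℝ, ℂ),
      -- the positive measure `μ` is tempered, and `T` is `μ` as a tempered distribution
      (∀ φ : 𝓢(ℝ, ℂ), MeasureTheory.Integrable φ (zeroMeasure P b) ∧
        T φ = ∫ x, φ x ∂(zeroMeasure P b)) ∧
      -- it is the sum of delta masses `m(γ) δ_γ` over a discrete set, with `m(γ) ≥ 1` exactly
      -- at the zeros `iγ` of `F`
      IsDiscreteSum T (fun γ => (zeroMult P b γ : ℂ)) ∧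
      (∀ γ : ℝ, 1 ≤ zeroMult P b γ ↔ γ ∈ zeroSet P b) ∧
      IsCrystalline T ∧
      IsFourierQuasicrystal T ∧
      -- the summation formula, for every Schwartz function
      (∀ h : 𝓢(ℝ, ℂ),
        Summable (fun k : Fin n →₀ ℕ => (logDot b k : ℂ) * logCoeff P k * h (logDot b k)) ∧
        Summable (fun k : Fin n →₀ ℕ => (logDot b k : ℂ) * logCoeff Q k * h (-logDot b k)) ∧
        HasSum (fun γ : zeroSet P b => (zeroMult P b γ : ℂ) * fourierS h γ)
          ((logDot b ℓ : ℂ) * h 0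
            - (∑' k : Fin n →₀ ℕ, (logDot b k : ℂ) * logCoeff P k * h (logDot b k))
            - (∑' k : Fin n →₀ ℕ, (logDot b k : ℂ) * logCoeff Q k * h (-logDot b k))) ∧
        fourierT T h =
          (logDot b ℓ : ℂ) * h 0
            - (∑' k : Fin n →₀ ℕ, (logDot b k : ℂ) * logCoeff P k * h (logDot b k))
            - (∑' k : Fin n →₀ ℕ, (logDot b k : ℂ) * logCoeff Q k * h (-logDot b k))) ∧
      -- the Fourier transform is supported on `L₊ ∪ -L₊ ∪ {0}`
      (∃ c : ℝ → ℂ, IsDiscreteSum (fourierT T) c ∧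
        Function.support c ⊆ Lplus b ∪ {x | -x ∈ Lplus b} ∪ {0}) ∧
      IsAlmostPeriodicMeasure (zeroMeasure P b) := by 
  have hsupp := hPQ.support_zeroMult hb
  obtain ⟨T, hT, hTF⟩ := hPQ.exists_temperedDistribution hb
  have hzero : ∀ φ : 𝓢(ℝ, ℂ),
      HasSum (fun γ : zeroSet P b => (zeroMult P b γ : ℂ) * φ γ) (T φ) := fun φ =>
    (hasSum_subtype_iff_of_support_subset (f := fun γ : ℝ => (zeroMult P b γ : ℂ) * φ γ)
      (hsupp ▸ Function.support_mul_subset_left _ _)).mpr (hT φ)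
  have hfinite : ∀ R : ℝ,
      (Function.support (fun γ => (zeroMult P b γ : ℂ)) ∩ Set.Icc (-R) R).Finite := fun R => by
    rw [hsupp]
    exact hPQ.finite_zeroSet_inter hb R
  have hdT : IsDiscreteSum T (fun γ => (zeroMult P b γ : ℂ)) := isDiscreteSum_of_hasSum hfinite hT
  have hx := finite_spectralPoint (n := n) hb
  have hdF : IsDiscreteSum (fourierT T) (massAt (spectralMass P Q ℓ b) (spectralPoint b)) :=
    isDiscreteSum_massAt hx hTF
  refine ⟨fun s hs => ?_, T, fun φ => ?_, hdT, hPQ.one_le_zeroMult_iff hb, ⟨_, _, hdT, hdF⟩,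
    ⟨_, _, hdT, hdF, ⟨T, ?_⟩, ?_⟩, fun h => ?_, ⟨_, hdF, massAt_spectral_support _ b⟩,
    hPQ.isAlmostPeriodicMeasure hb⟩
  · by_contra h
    exact hPQ.dirichletPoly_left_ne_zero hb h hs
  · have hsum : Summable fun γ : ℝ => (zeroMult P b γ : ℝ) * ‖φ γ‖ :=
      (hT φ).summable.norm.congr fun γ => by rw [norm_mul, Complex.norm_natCast]
    obtain ⟨hint, h⟩ := hPQ.hasSum_zeroMeasure hb hsum
    exact ⟨hint, (hzero φ).unique h⟩
  -- Multiplicities are nonnegative, so `|μ| = μ` and `T` itself serves.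
  · simpa using hdT
  · exact exists_isDiscreteSum_norm (finite_support_massAt _ hx)
      (summable_norm_massAt hx (summable_spectralMass hPQ hb))
  · obtain ⟨hP, hQ, hval⟩ := summable_and_eq_of_hasSum_spectral (hTF h)
    refine ⟨hP, hQ, ?_, hval⟩
    rw [← hval]
    exact hzero (fourierS h)
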